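/- **Theorem (abstract Chernoff theorem).** Let $w$ be a positive measurable function on $\mathbb R^+=(0,\infty)$ and let $\tilde w$ be an even measurable function on $\mathbb R$, positive on $\mathbb R\setminus\{0\}$ and of at most polynomial growth: $\tilde w(\lambda)\le C(1+|\lambda|)^N$ for all $\lambda\in\mathbb R$, with some $C,N$. Let $L=\sum_{k=0}^n a_k(r)\frac{d^k}{dr^k}$ be a differential operator with coefficients $a_k\in C^\infty(\mathbb R^+)$, self-adjoint in $L^2(\mathbb R^+,w(r)\,dr)$ in the following sense. There is a linear space $\mathcal D\supset C_c^\infty(\mathbb R^+)$ of functions $u\in C^\infty(\mathbb R^+)$ which vanish for large $r$ and satisfy $u,Lu\in L^2(\mathbb R^+,w\,dr)$, and $L$ with domain $\mathcal D$ is essentially self-adjoint in $L^2(\mathbb R^+,w\,dr)$, that is, its closure is a self-adjoint operator. (For the Bessel and Jacobi operators, $\mathcal D$ consists of the restrictions to $\mathbb R^+$ of the even functions in $C_c^\infty(\mathbb R)$.) Let $\delta>0$, and for each $\lambda\in\mathbb R$ let $\psi_\lambda$ be a bounded continuous function on $[0,\infty)$ with $\psi_\lambda(0)=1$ and $\psi_{-\lambda}=\psi_\lambda$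 which on each interval $(0,R)$ agrees with some element of $\mathcal D$ and satisfies $L\psi_\lambda=(\lambda^2+\delta^2)\psi_\lambda$ on $\mathbb R^+$. Suppose that $$Tf(\lambda)=\int_0^\infty f(r)\psi_\lambda(r)w(r)\,dr,\qquad f\in L^1(\mathbb R^+,w\,dr)\cap L^2(\mathbb R^+,w\,dr),$$ extends to a linear map $T:L^2(\mathbb R^+,w(r)dr)\to L^2(\mathbb R,\tilde w(\lambda)d\lambda)$ and that, for some constant $c>0$, one has the Plancherel formula $$\|f\|^2_{L^2(\mathbb R^+,w\,dr)}=c\int_{-\infty}^\infty|Tf(\lambda)|^2\,\tilde w(\lambda)\,d\lambda\qquad\text{for all } f\in L^2(\mathbb R^+,w\,dr),$$ and the inversion formula $$f(r)=c\int_{-\infty}^\infty Tf(\lambda)\,\psi_\lambda(r)\,\tilde w(\lambda)\,d\lambda\qquad\text{for almost every } r>0,$$ with an absolutely convergent integral, for all $f$ in some dense subset of $L^2(\mathbb R^+,w\,dr)$. Let $f\in L^2(\mathbb R^+,w(r)dr)$ be such that $L^mf\in L^2(\mathbb R^+,w(r)dr)$ for all $m\in\mathbb N$, where $L^mf$ is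 taken in the sense of distributions (that is, $\int_0^\infty f\,\overline{L^m\varphi}\,w\,dr=\int_0^\infty (L^mf)\,\overline{\varphi}\,w\,dr$ for all $\varphi\in C_c^\infty(\mathbb R^+)$), and suppose that the Carleman condition $$\sum_{m=1}^\infty\|L^mf\|_{L^2(\mathbb R^+,w\,dr)}^{-1/(2m)}=\infty$$ holds (with $0^{-1/(2m)}=\infty$). Then $f$ cannot vanish almost everywhere in a neighbourhood $(0,\eta)$, $\eta>0$, of $0$ unless $f=0$ almost everywhere. -/

import Mathlib

open MeasureTheory Set

open scoped ENNReal ContDiff ComplexConjugate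

namespace Chernoff

noncomputable section

/-- The measure `w(r) dr` on the half-line `(0, ∞)`. -/
def halfLineMeasure (w : ℝ → ℝ) : Measure ℝ :=
  (volume.restrict (Ioi 0)).withDensity fun r => ENNReal.ofReal (w r)

/-- The measure `w̃(lam) dlam` on `ℝ`. -/
def lineMeasure (wt : ℝ → ℝ) : Measure ℝ :=
  volume.withDensity fun lam => ENNReal.ofReal (wt lam)

/-- The Hilbert space `L²((0, ∞), w(r) dr)`. -/
abbrev HalfLineL2 (w : ℝ → ℝ) : Type := Lp ℂ 2 (halfLineMeasure w)

/-- The Hilbert space `L²(ℝ, w̃(lam) dlam)`. -/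
abbrev LineL2 (wt : ℝ → ℝ) : Type := Lp ℂ 2 (lineMeasure wt)

/-- The differential expression `(L u)(r) = ∑_{k ≤ n} a_k(r) u^{(k)}(r)`. -/
def diffOp (n : ℕ) (a : ℕ → ℝ → ℂ) (u : ℝ → ℂ) : ℝ → ℂ := fun r =>
  ∑ k ∈ Finset.range (n + 1), a k r * iteratedDeriv k u r

/-- `C_c^∞((0, ∞))`; the functions are extended by `0` to `ℝ`. -/
def IsTestFunction (φ : ℝ → ℂ) : Prop :=
  ContDiff ℝ ∞ φ ∧ HasCompactSupport φ ∧ tsupport φ ⊆ Ioi 0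

/-- `D` is an admissible initial domain in `L²(w dr)` for the differential expression `L`: it
consists of functions that are smooth on `(0, ∞)` and vanish for large `r`, such that `u` and
`L u` are square integrable, and it contains `C_c^∞((0, ∞))`. The behaviour at `0` of the members
of `D` encodes the boundary condition at `0`, if there is any. Only the values on `(0, ∞)`
matter. -/
structure IsInitialDomain (w : ℝ → ℝ) (n : ℕ) (a : ℕ → ℝ → ℂ)
    (D : Submodule ℂ (ℝ → ℂ)) : Prop where
  contDiffOn : ∀ u ∈ D, ContDiffOn ℝ ∞ u (Ioi 0)
  eventually_zero : ∀ u ∈ D, ∃ R : ℝ, ∀ r > R, u r = 0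
  memLp : ∀ u ∈ D, MemLp u 2 (halfLineMeasure w)
  memLp_diffOp : ∀ u ∈ D, MemLp (diffOp n a u) 2 (halfLineMeasure w)
  test_mem : ∀ φ : ℝ → ℂ, IsTestFunction φ → φ ∈ D

/-- The differential expression `L` with initial domain `D` is essentially self-adjoint in
`L²(w dr)`: the closure of its graph is the graph of a self-adjoint operator. -/
def IsEssentiallySelfAdjoint (w : ℝ → ℝ) (n : ℕ) (a : ℕ → ℝ → ℂ)
    (D : Submodule ℂ (ℝ → ℂ)) : Prop :=
  ∃ A : HalfLineL2 w →ₗ.[ℂ] HalfLineL2 w, IsSelfAdjoint A ∧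
    (A.graph : Set (HalfLineL2 w × HalfLineL2 w)) =
      closure {p | ∃ u ∈ D, p.1 =ᵐ[halfLineMeasure w] u ∧
        p.2 =ᵐ[halfLineMeasure w] diffOp n a u}

/-- `v` lies in `D` locally: on each interval `(0, R)` it agrees with a member of `D` (so it
satisfies the same condition at `0` as the members of `D`, and none at infinity). -/
def IsLocallyIn (D : Submodule ℂ (ℝ → ℂ)) (v : ℝ → ℂ) : Prop :=
  ∀ R : ℝ, ∃ u ∈ D, ∀ r ∈ Ioo 0 R, u r = v r

/-- `g = L^m f` in the sense of distributions on `(0, ∞)`, for a differential expression `L` that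
is formally self-adjoint with respect to `w dr`. -/
def IsPower (w : ℝ → ℝ) (n : ℕ) (a : ℕ → ℝ → ℂ) (m : ℕ) (f g : HalfLineL2 w) : Prop :=
  ∀ φ : ℝ → ℂ, IsTestFunction φ →
    ∫ r, f r * conj ((diffOp n a)^[m] φ r) ∂halfLineMeasure w =
      ∫ r, g r * conj (φ r) ∂halfLineMeasure w

/-- `T f(lam) = ∫_0^∞ f(r) ψ_lam(r) w(r) dr` for all `f ∈ L¹ ∩ L²`, a dense subspace of `L²`. -/
def IsEigenfunctionTransform (w wt : ℝ → ℝ) (ψ : ℝ → ℝ → ℂ)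
    (T : HalfLineL2 w →ₗ[ℂ] LineL2 wt) : Prop :=
  ∀ f : HalfLineL2 w, Integrable f (halfLineMeasure w) →
    T f =ᵐ[lineMeasure wt] fun lam => ∫ r, f r * ψ lam r ∂halfLineMeasure w

/-- The inversion formula `f(r) = c ∫ T f(lam) ψ_lam(r) w̃(lam) dlam` on a dense class. -/
def InversionFormula (w wt : ℝ → ℝ) (ψ : ℝ → ℝ → ℂ) (c : ℝ)
    (T : HalfLineL2 w →ₗ[ℂ] LineL2 wt) : Prop :=
  ∃ S : Set (HalfLineL2 w), Dense S ∧ ∀ f ∈ S, ∀ᵐ r ∂halfLineMeasure w,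
    Integrable (fun lam => T f lam * ψ lam r) (lineMeasure wt) ∧
      f r = c * ∫ lam, T f lam * ψ lam r ∂lineMeasure wt

/-- The Plancherel formula `‖f‖² = c ∫ |T f(lam)|² w̃(lam) dlam`. -/
def PlancherelFormula (w wt : ℝ → ℝ) (c : ℝ) (T : HalfLineL2 w →ₗ[ℂ] LineL2 wt) : Prop :=
  ∀ f : HalfLineL2 w, ‖f‖ ^ 2 = c * ∫ lam, ‖T f lam‖ ^ 2 ∂lineMeasure wt

end

end Chernoff

/-!
Write `μ = w dr`, `ν = w̃ dλ` and `x = λ² + δ²`. The argument runs through the transform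
`Sf = conj (T (conj f))`, that is `Sf(λ) = ∫ f conj(ψ_λ) dμ` (`conjTransform`). It satisfies the same
Plancherel formula as `T`, and, unlike `T` itself, it visibly diagonalises the closure `A` of `L`:
since `L` is symmetric on `D` for the sesquilinear pairing and `ψ_λ` is locally in `D`,
`S(Lu) = x · Su` for `u ∈ D`, hence `S(Af) = x · Sf` on the domain of `A`
(`conjTransform_intertwines`).

Because `f` vanishes near `0`, so do all the distributions `L^m f`, and a cutoff near `0` turns the
distributional relation `L (L^m f) = L^{m+1} f`, tested against `C_c^∞`, into one tested against
`D`. As `A` is self-adjoint, `f` is in the domain of every `A^m`, with `A^m f = L^m f`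
(`mem_graph_of_ae_eq_zero`). So `S(L^m f) = x^m · Sf`.

Let `k` be the indicator function of an interval `(0, ε)` on which `f` vanishes. Then
`0 = ⟨k, L^m f⟩ = c ∫ x^m Sf conj(Sk) dν` for all `m`, while
`∫ x^m |Sf| |Sk| dν ≤ ‖k‖ ‖L^m f‖ / c`. Thus the even function `Sf · conj(Sk) · w̃` on `ℝ` has
vanishing moments of all orders, and its absolute moments satisfy Carleman's condition. Such a
function vanishes (`ae_eq_zero_of_moments_eq_zero`): its Fourier transform is flat at `0`, so that
it is zero by the Denjoy–Carleman theorem, for which Bang's proof is used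
(`eq_zero_of_flat_of_not_summable`); absolute moments are automatically logarithmically convex.

Finally `Sk(λ) = ∫_0^ε conj(ψ_λ) dμ ≠ 0` for small `ε`, because `ψ_λ(0) = 1`
(`exists_setIntegral_ne_zero`). Letting `ε` run through a sequence tending to `0` gives `Sf = 0`
almost everywhere, and `f = 0` by the Plancherel formula.
-/

open MeasureTheory Set

open scoped ENNReal ContDiff ComplexConjugate

namespace Chernoff

open Filter Topology

/-! ### The Taylor remainder of the exponential on the imaginary axis -/

theorem norm_exp_mul_I_sub_sum_le (m : ℕ) (θ : ℝ) (hθ : 0 ≤ θ) (σ : ℝ) (hσ : |σ| ≤ 1) :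
    ‖Complex.exp (θ * (σ * Complex.I)) -
      ∑ j ∈ Finset.range m, (θ * (σ * Complex.I)) ^ j / (j.factorial : ℂ)‖ ≤
        θ ^ m / m.factorial := by
  induction m generalizing θ with
  | zero =>
    simp [Complex.norm_exp]
  | succ m ih =>
    have hσ' : ‖(σ * Complex.I : ℂ)‖ ≤ 1 := by simpa using hσ
    have hderiv : ∀ x : ℝ, HasDerivAt (fun x : ℝ => Complex.exp (x * (σ * Complex.I)) -
        ∑ j ∈ Finset.range (m + 1), (x * (σ * Complex.I)) ^ j / (j.factorial : ℂ))
        ((σ * Complex.I) * (Complex.exp (x * (σ * Complex.I)) -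
        ∑ j ∈ Finset.range m, (x * (σ * Complex.I)) ^ j / (j.factorial : ℂ))) x := by
      intro x
      have h0 : HasDerivAt (fun x : ℝ => (x : ℂ) * (σ * Complex.I)) (1 * (σ * Complex.I)) x :=
        (Complex.ofRealCLM.hasDerivAt (x := x)).mul_const _
      have h1 := h0.cexp
      have h2 : HasDerivAt (fun x : ℝ => ∑ j ∈ Finset.range (m + 1),
          (x * (σ * Complex.I)) ^ j / (j.factorial : ℂ))
          (∑ j ∈ Finset.range (m + 1), (j * (x * (σ * Complex.I)) ^ (j - 1) *
            (1 * (σ * Complex.I))) / (j.factorial : ℂ)) x :=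
        HasDerivAt.fun_sum fun j _ => (h0.pow j).div_const _
      refine (h1.sub h2).congr_deriv (Eq.symm ?_)
      rw [Finset.sum_range_succ']
      simp only [mul_sub, Finset.mul_sum]
      congr 1
      · ring
      · simp only [Nat.cast_zero, zero_mul, zero_div, add_zero]
        refine Finset.sum_congr rfl fun j _ => ?_
        rw [Nat.factorial_succ]
        have : (j.factorial : ℂ) ≠ 0 := by exact_mod_cast j.factorial_ne_zero
        have : ((j : ℂ) + 1) ≠ 0 := by exact_mod_cast j.succ_ne_zero
        push_cast
        field_simp
    have hB : ∀ x : ℝ, HasDerivAt (fun x : ℝ => x ^ (m + 1) / ((m + 1).factorial : ℝ))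
        (x ^ m / m.factorial) x := by
      intro x
      refine ((hasDerivAt_pow (m + 1) x).div_const _).congr_deriv ?_
      rw [Nat.factorial_succ]
      have : (m.factorial : ℝ) ≠ 0 := by exact_mod_cast m.factorial_ne_zero
      push_cast
      field_simp
    refine image_norm_le_of_norm_deriv_right_le_deriv_boundary (a := 0) (b := θ)
      (fun x _ => (hderiv x).continuousAt.continuousWithinAt)
      (fun x _ => (hderiv x).hasDerivWithinAt) ?_ hB (fun x hx => ?_) ⟨hθ, le_rfl⟩
    · simp [Finset.sum_range_succ']
    · rw [norm_mul]
      exact (mul_le_of_le_one_left (norm_nonneg _) hσ').trans (ih x hx.1)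

/-! ### Carleman's inequality -/

/-- Carleman's inequality for finite sums, with the constant `2e` instead of the optimal `e`. It
follows from the inequality of the means for the numbers `(j + 1) a_j`, from
`(n + 1)! ≥ ((n + 1) / e) ^ (n + 1)` and from a summation by parts. -/
theorem sum_geometric_mean_le (a : ℕ → ℝ) (ha : ∀ n, 0 < a n) (N : ℕ) :
    ∑ n ∈ Finset.range N, (∏ j ∈ Finset.range (n + 1), a j) ^ (1 / ((n : ℝ) + 1)) ≤
      2 * Real.exp 1 * ∑ j ∈ Finset.range N, a j := by
  set A : ℕ → ℝ := fun n => ∑ j ∈ Finset.range n, ((j : ℝ) + 1) * a j with hA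
  have hA0 : ∀ n, 0 ≤ A n := fun n => Finset.sum_nonneg fun j _ => by
    have := ha j; positivity
  have hterm : ∀ n : ℕ, (∏ j ∈ Finset.range (n + 1), a j) ^ (1 / ((n : ℝ) + 1)) ≤
      2 * Real.exp 1 * (A (n + 1) / (((n : ℝ) + 1) * ((n : ℝ) + 2))) := by
    intro n
    have hn : (0 : ℝ) < (n : ℝ) + 1 := by positivity
    have hP : 0 ≤ ∏ j ∈ Finset.range (n + 1), a j := Finset.prod_nonneg fun j _ => (ha j).le
    have hag := Real.geom_mean_le_arith_mean_weighted (Finset.range (n + 1))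
      (fun _ => 1 / ((n : ℝ) + 1)) (fun j => ((j : ℝ) + 1) * a j) (fun _ _ => by positivity)
      (by simp; field_simp) (fun j _ => by have := ha j; positivity)
    rw [Real.finsetProd_rpow _ _ (fun j _ => by have := ha j; positivity),
      Finset.prod_mul_distrib, ← Finset.mul_sum] at hag
    have hfac : ∏ j ∈ Finset.range (n + 1), ((j : ℝ) + 1) = (n + 1).factorial := by
      rw [← Finset.prod_range_add_one_eq_factorial]; push_cast; rfl
    rw [hfac, Real.mul_rpow (by positivity) hP] at hag
    have hf : ((n : ℝ) + 1) / Real.exp 1 ≤ ((n + 1).factorial : ℝ) ^ (1 / ((n : ℝ) + 1)) := by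
      have h := Real.pow_div_factorial_le_exp ((n : ℝ) + 1) hn.le (n + 1)
      have h2 : (((n : ℝ) + 1) / Real.exp 1) ^ (n + 1) ≤ (n + 1).factorial := by
        rw [div_pow, ← Real.exp_nat_mul, div_le_iff₀ (Real.exp_pos _)]
        rw [div_le_iff₀ (by positivity)] at h
        push_cast
        rw [mul_one]
        linarith
      have h3 := Real.rpow_le_rpow (by positivity) h2 (show 0 ≤ 1 / ((n : ℝ) + 1) by positivity)
      rwa [← Real.rpow_natCast, ← Real.rpow_mul (by positivity), show
        ((n + 1 : ℕ) : ℝ) * (1 / ((n : ℝ) + 1)) = 1 by push_cast; field_simp, Real.rpow_one] at h3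
    have h4 := (mul_le_mul_of_nonneg_right hf (Real.rpow_nonneg hP _)).trans hag
    set G := (∏ j ∈ Finset.range (n + 1), a j) ^ (1 / ((n : ℝ) + 1))
    have h5 : G ≤ Real.exp 1 * (A (n + 1) / (((n : ℝ) + 1) * ((n : ℝ) + 1))) := by
      have he := Real.exp_pos 1
      calc G = (Real.exp 1 / ((n : ℝ) + 1)) * (((n : ℝ) + 1) / Real.exp 1 * G) := by field_simp
        _ ≤ (Real.exp 1 / ((n : ℝ) + 1)) * (1 / ((n : ℝ) + 1) * A (n + 1)) := by gcongr
        _ = _ := by field_simp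
    refine h5.trans ?_
    rw [mul_comm 2, mul_assoc]
    gcongr
    rw [← mul_div_assoc, div_le_div_iff₀ (by positivity) (by positivity)]
    have := mul_nonneg (hA0 (n + 1)) (show 0 ≤ ((n : ℝ) + 1) * n by positivity)
    nlinarith
  -- Summation by parts.
  have hsum : ∀ N : ℕ, ∑ n ∈ Finset.range N, A (n + 1) / (((n : ℝ) + 1) * ((n : ℝ) + 2)) +
      A N / ((N : ℝ) + 1) = ∑ j ∈ Finset.range N, a j := by
    intro N
    induction N with
    | zero => simp [hA]
    | succ N ih =>
      rw [Finset.sum_range_succ, Finset.sum_range_succ, ← ih]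
      have : A (N + 1) = A N + ((N : ℝ) + 1) * a N := Finset.sum_range_succ _ _
      rw [this]
      push_cast
      field_simp
      ring
  calc _ ≤ ∑ n ∈ Finset.range N, 2 * Real.exp 1 * (A (n + 1) / (((n : ℝ) + 1) * ((n : ℝ) + 2))) :=
        Finset.sum_le_sum fun n _ => hterm n
    _ = 2 * Real.exp 1 * ∑ n ∈ Finset.range N, (A (n + 1) / (((n : ℝ) + 1) * ((n : ℝ) + 2))) := by
        rw [Finset.mul_sum]
    _ ≤ _ := by
        refine mul_le_mul_of_nonneg_left ?_ (by positivity)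
        rw [← hsum N]
        have := hA0 N
        linarith [show 0 ≤ A N / ((N : ℝ) + 1) by positivity]

/-- The two usual forms of the Denjoy–Carleman condition: `∑ M_n ^ (-1/n) = ∞` implies
`∑ M_n / M_{n+1} = ∞`, by Carleman's inequality for the ratios `M_n / M_{n+1}`. -/
theorem not_summable_ratio_of_not_summable_rpow (M : ℕ → ℝ) (hM : ∀ n, 0 < M n)
    (h : ¬ Summable fun n : ℕ => M (n + 1) ^ (-(1 / ((n : ℝ) + 1)))) :
    ¬ Summable fun n => M n / M (n + 1) := by
  intro hs
  apply h
  have ha : ∀ n, 0 < M n / M (n + 1) := fun n => div_pos (hM _) (hM _)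
  have hprod : ∀ n : ℕ, ∏ j ∈ Finset.range n, M j / M (j + 1) = M 0 / M n := by
    intro n
    induction n with
    | zero => simp [(hM 0).ne']
    | succ n ih =>
      rw [Finset.prod_range_succ, ih]
      have := hM n
      have := hM (n + 1)
      field_simp
  have hs2 : Summable fun n : ℕ => (M 0 / M (n + 1)) ^ (1 / ((n : ℝ) + 1)) := by
    refine summable_of_sum_range_le (c := 2 * Real.exp 1 * ∑' n, M n / M (n + 1))
      (fun n => Real.rpow_nonneg (div_pos (hM _) (hM _)).le _) fun N => ?_
    have := sum_geometric_mean_le _ ha N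
    simp only [hprod] at this
    refine this.trans ?_
    gcongr
    exact hs.sum_le_tsum _ fun i _ => (ha i).le
  have hc : 0 < min (M 0) 1 := lt_min (hM 0) one_pos
  refine Summable.of_nonneg_of_le (fun n => Real.rpow_nonneg (hM _).le _) (fun n => ?_)
    (hs2.mul_left (min (M 0) 1)⁻¹)
  rw [Real.div_rpow (hM _).le (hM _).le, Real.rpow_neg (hM _).le, div_eq_mul_inv (M 0 ^ _),
    ← mul_assoc]
  refine le_mul_of_one_le_left (by have := hM (n + 1); positivity) ?_
  rw [inv_mul_eq_div, one_le_div hc]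
  have hn : 1 / ((n : ℝ) + 1) ≤ 1 := by
    rw [div_le_one (by positivity)]; linarith [Nat.cast_nonneg (α := ℝ) n]
  calc min (M 0) 1 = min (M 0) 1 ^ (1 : ℝ) := (Real.rpow_one _).symm
    _ ≤ min (M 0) 1 ^ (1 / ((n : ℝ) + 1)) :=
        Real.rpow_le_rpow_of_exponent_ge hc (min_le_right _ _) hn
    _ ≤ _ := Real.rpow_le_rpow hc.le (min_le_left _ _) (by positivity)

/-! ### Bang's proof of the Denjoy–Carleman theorem -/

/-- Bang's lemma. The functions `G n` play the role of the successive derivatives of `G 0`, which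
is expressed by the Taylor estimate `htaylor` alone. Moving by at most `M_N / (e M_{N+1})` to the
right costs at most a factor `e` in the estimate `‖G n x‖ ≤ e ^ (n - N - 1) M_n` (for all `n`). -/
theorem norm_add_le_of_norm_le_exp (G : ℕ → ℝ → ℂ) (M : ℕ → ℝ) (hM : ∀ n, 0 < M n)
    (hconv : Antitone fun n => M n / M (n + 1)) (hG : ∀ n x, ‖G n x‖ ≤ M n)
    (htaylor : ∀ n m x h, 0 ≤ h → ‖G n (x + h) -
      ∑ i ∈ Finset.range m, ((h ^ i / i.factorial : ℝ) : ℂ) * G (n + i) x‖ ≤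
        M (n + m) * (h ^ m / m.factorial))
    (N : ℕ) (x h : ℝ) (hx : ∀ n, ‖G n x‖ ≤ Real.exp ((n : ℝ) - (N + 1 : ℕ)) * M n)
    (h0 : 0 ≤ h) (h1 : h ≤ M N / M (N + 1) / Real.exp 1) (n : ℕ) :
    ‖G n (x + h)‖ ≤ Real.exp ((n : ℝ) - N) * M n := by
  rcases Nat.lt_or_ge N n with hn | hn
  · refine (hG n _).trans (le_mul_of_one_le_left (hM n).le ?_)
    rw [Real.one_le_exp_iff, sub_nonneg]
    exact_mod_cast hn.le
  set q := M N / M (N + 1) with hq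
  have hq0 : 0 < q := div_pos (hM _) (hM _)
  -- `M n / M (n + i)` is a product of `i` ratios, none of them smaller than `q`.
  have hpow : ∀ i, n + i ≤ N + 1 → M (n + i) * q ^ i ≤ M n := by
    intro i
    induction i with
    | zero => simp
    | succ i ih =>
      intro hi
      have h2 : q ≤ M (n + i) / M (n + i + 1) := hconv (by omega : n + i ≤ N)
      rw [le_div_iff₀ (hM _)] at h2
      calc M (n + (i + 1)) * q ^ (i + 1) = (q * M (n + i + 1)) * q ^ i := by
            rw [pow_succ, ← add_assoc]; ring
        _ ≤ M (n + i) * q ^ i := by gcongr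
        _ ≤ M n := ih (by omega)
  have hh : ∀ i : ℕ, h ^ i ≤ q ^ i * Real.exp (-(i : ℝ)) := by
    intro i
    refine (pow_le_pow_left₀ h0 h1 i).trans_eq ?_
    rw [div_pow, ← Real.exp_nat_mul, mul_one, Real.exp_neg, div_eq_mul_inv]
  set m := N + 1 - n with hm
  have hnm : n + m = N + 1 := by omega
  have hnmR : (n : ℝ) + m = (N + 1 : ℕ) := by exact_mod_cast hnm
  have hT := htaylor n m x h h0
  set E := Real.exp ((n : ℝ) - (N + 1 : ℕ)) with hE
  have hterm : ∀ i ∈ Finset.range m, ‖((h ^ i / i.factorial : ℝ) : ℂ) * G (n + i) x‖ ≤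
      E * M n * (1 ^ i / i.factorial) := by
    intro i hi
    have hi' := Finset.mem_range.1 hi
    rw [norm_mul, Complex.norm_real, Real.norm_of_nonneg (by positivity)]
    have hfi : (0 : ℝ) < i.factorial := by positivity
    calc h ^ i / i.factorial * ‖G (n + i) x‖
        ≤ (q ^ i * Real.exp (-(i : ℝ))) / i.factorial *
            (Real.exp (((n + i : ℕ) : ℝ) - (N + 1 : ℕ)) * M (n + i)) := by
          gcongr
          · exact hh i
          · exact hx _
      _ = (M (n + i) * q ^ i) * E * (1 / i.factorial) := by
          have : Real.exp (((n + i : ℕ) : ℝ) - (N + 1 : ℕ)) = E * Real.exp i := by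
            rw [hE, ← Real.exp_add]; push_cast; ring_nf
          rw [this, Real.exp_neg]
          have := Real.exp_pos (i : ℝ)
          field_simp
      _ ≤ M n * E * (1 / i.factorial) := by
          gcongr
          exact hpow i (by omega)
      _ = _ := by rw [one_pow]; ring
  have hrem : M (n + m) * (h ^ m / m.factorial) ≤ E * M n * (1 ^ m / m.factorial) := by
    have hfi : (0 : ℝ) < m.factorial := by positivity
    have := (hM (n + m)).le
    calc M (n + m) * (h ^ m / m.factorial)
        ≤ M (n + m) * ((q ^ m * Real.exp (-(m : ℝ))) / m.factorial) := by
          gcongr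
          exact hh m
      _ = (M (n + m) * q ^ m) * E * (1 / m.factorial) := by
          have : E = Real.exp (-(m : ℝ)) := by rw [hE, ← hnmR]; ring_nf
          rw [this]; ring
      _ ≤ M n * E * (1 / m.factorial) := by
          gcongr
          exact hpow m hnm.le
      _ = _ := by rw [one_pow]; ring
  calc ‖G n (x + h)‖ ≤ ‖∑ i ∈ Finset.range m, ((h ^ i / i.factorial : ℝ) : ℂ) * G (n + i) x‖ +
        ‖G n (x + h) - ∑ i ∈ Finset.range m, ((h ^ i / i.factorial : ℝ) : ℂ) * G (n + i) x‖ :=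
        norm_le_norm_add_norm_sub' _ _
    _ ≤ ∑ i ∈ Finset.range m, E * M n * (1 ^ i / i.factorial) +
        E * M n * (1 ^ m / m.factorial) :=
        add_le_add ((norm_sum_le _ _).trans (Finset.sum_le_sum hterm)) (hT.trans hrem)
    _ = E * M n * ∑ i ∈ Finset.range (m + 1), 1 ^ i / (i.factorial : ℝ) := by
        rw [Finset.sum_range_succ, mul_add, Finset.mul_sum]
    _ ≤ E * M n * Real.exp 1 := by
        have := (hM n).le
        gcongr
        exact Real.sum_le_exp_of_nonneg zero_le_one _
    _ = Real.exp ((n : ℝ) - N) * M n := by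
        have : Real.exp ((n : ℝ) - N) = E * Real.exp 1 := by
          rw [hE, ← Real.exp_add]; push_cast; ring_nf
        rw [this]; ring

/-- The Denjoy–Carleman theorem. As in `norm_add_le_of_norm_le_exp`, the sequence `G n` stands for
the successive derivatives of `G 0`. At the point `0` the estimate `‖G n‖ ≤ e ^ (n - N) M_n` holds
for every `N`; moving to the right, one can pay for the loss of all the exponents between `N` and
`K` by an arbitrarily long way, since `∑ M_j / M_{j+1}` diverges. So the estimate holds for every
`K` at every point. -/
theorem eq_zero_of_flat_of_not_summable (G : ℕ → ℝ → ℂ) (M : ℕ → ℝ) (hM : ∀ n, 0 < M n)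
    (hconv : Antitone fun n => M n / M (n + 1)) (hG : ∀ n x, ‖G n x‖ ≤ M n)
    (htaylor : ∀ n m x h, 0 ≤ h → ‖G n (x + h) -
      ∑ i ∈ Finset.range m, ((h ^ i / i.factorial : ℝ) : ℂ) * G (n + i) x‖ ≤
        M (n + m) * (h ^ m / m.factorial))
    (hdiv : ¬ Summable fun n => M n / M (n + 1)) (hzero : ∀ n, G n 0 = 0)
    (x : ℝ) (hx : 0 ≤ x) : G 0 x = 0 := by
  have ha : ∀ n, 0 ≤ M n / M (n + 1) := fun n => (div_pos (hM _) (hM _)).le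
  have key : ∀ (d K : ℕ) (x : ℝ), 0 ≤ x →
      x ≤ (∑ j ∈ Finset.range d, M (j + K) / M (j + K + 1)) / Real.exp 1 →
      ∀ n : ℕ, ‖G n x‖ ≤ Real.exp ((n : ℝ) - K) * M n := by
    intro d
    induction d with
    | zero =>
      intro K x hx hx' n
      obtain rfl : x = 0 := le_antisymm (by simpa using hx') hx
      rw [hzero, norm_zero]
      exact mul_nonneg (Real.exp_pos _).le (hM n).le
    | succ d ih =>
      intro K x hx hx' n
      -- The last step, from `min x S` to `x`, has length at most `M K / (e M (K + 1))`.
      set S := (∑ j ∈ Finset.range d, M (j + (K + 1)) / M (j + (K + 1) + 1)) / Real.exp 1 with hS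
      have hS0 : 0 ≤ S := div_nonneg (Finset.sum_nonneg fun _ _ => ha _) (Real.exp_pos _).le
      have hx2 : x ≤ S + M K / M (K + 1) / Real.exp 1 := by
        rw [Finset.sum_range_succ', add_div] at hx'
        simpa [hS, add_assoc, add_comm 1] using hx'
      have hstep := norm_add_le_of_norm_le_exp G M hM hconv hG htaylor K (min x S) (x - min x S)
        (ih (K + 1) _ (le_min hx hS0) (min_le_right _ _)) (sub_nonneg.2 (min_le_left _ _))
        (by
          rcases le_total x S with h | h
          · rw [min_eq_left h, sub_self]
            exact div_nonneg (ha _) (Real.exp_pos _).le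
          · rw [min_eq_right h]; linarith) n
      simpa using hstep
  have hbound : ∀ K : ℕ, ‖G 0 x‖ ≤ Real.exp (-(K : ℝ)) * M 0 := by
    intro K
    have hd : ¬ Summable fun j => M (j + K) / M (j + K + 1) :=
      fun h => hdiv ((summable_nat_add_iff (f := fun n => M n / M (n + 1)) K).1 h)
    have ht := (not_summable_iff_tendsto_nat_atTop_of_nonneg fun j => ha (j + K)).1 hd
    obtain ⟨d, hd⟩ := (ht.eventually_ge_atTop (x * Real.exp 1)).exists
    simpa using key d K x hx ((le_div_iff₀ (Real.exp_pos _)).2 hd) 0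
  have hlim : Filter.Tendsto (fun K : ℕ => Real.exp (-(K : ℝ)) * M 0) Filter.atTop (nhds 0) := by
    simpa using ((Real.tendsto_exp_neg_atTop_nhds_zero.comp
      tendsto_natCast_atTop_atTop).mul_const (M 0))
  exact norm_le_zero_iff.1 (ge_of_tendsto' hlim hbound)

/-! ### Functions on the line with vanishing moments -/

open FourierTransform in
/-- An integrable function is determined by its Fourier transform. -/
theorem ae_eq_zero_of_integral_exp_eq_zero (F : ℝ → ℂ) (hF : Integrable F)
    (h : ∀ t : ℝ, ∫ l : ℝ, Complex.exp (t * (l * Complex.I)) * F l = 0) : F =ᵐ[volume] 0 := by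
  have hfour : ∀ t : ℝ, 𝓕 F t = 0 := by
    intro t
    rw [Real.fourier_real_eq_integral_exp_smul, ← h (-2 * Real.pi * t)]
    refine integral_congr_ae (.of_forall fun l => ?_)
    simp only [smul_eq_mul]
    congr 2
    push_cast
    ring
  refine ae_eq_zero_of_integral_contDiff_smul_eq_zero hF.locallyIntegrable fun g hg hc => ?_
  have hg₁ : HasCompactSupport (Complex.ofRealCLM ∘ g) := hc.comp_left rfl
  have hg₂ : ContDiff ℝ ∞ (Complex.ofRealCLM ∘ g) := by fun_prop
  set φ := hg₁.toSchwartzMap hg₂ with hφ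
  have h1 := VectorFourier.integral_fourierIntegral_smul_eq_flip (L := innerₗ ℝ) (μ := volume)
    (ν := volume) Real.continuous_fourierChar continuous_inner (𝓕⁻ φ).integrable hF
  have h2 : ∀ x, VectorFourier.fourierIntegral Real.fourierChar volume (innerₗ ℝ)
      (𝓕⁻ φ : SchwartzMap ℝ ℂ) x = φ x := by
    intro x
    have : 𝓕 (𝓕⁻ φ) = φ := FourierTransform.fourier_fourierInv_eq φ
    conv_rhs => rw [← this, SchwartzMap.fourier_coe]
    rfl
  have h3 : ∀ x, VectorFourier.fourierIntegral Real.fourierChar volume (innerₗ ℝ).flip F x = 0 := by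
    intro x
    rw [flip_innerₗ]
    exact hfour x
  simp only [h2, h3, smul_zero, integral_zero] at h1
  rw [← h1]
  refine integral_congr_ae (.of_forall fun x => ?_)
  simp [hφ]

/-- Absolute moments are logarithmically convex, by the Cauchy–Schwarz inequality. -/
theorem antitone_moment_ratio (F : ℝ → ℂ) (hint : ∀ n : ℕ, Integrable fun l : ℝ => |l| ^ n * ‖F l‖)
    (hpos : ∀ n : ℕ, 0 < ∫ l : ℝ, |l| ^ n * ‖F l‖) :
    Antitone fun n : ℕ => (∫ l : ℝ, |l| ^ n * ‖F l‖) / ∫ l : ℝ, |l| ^ (n + 1) * ‖F l‖ := by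
  refine antitone_nat_of_succ_le fun n => ?_
  rw [div_le_div_iff₀ (hpos _) (hpos _)]
  have hq : ∀ s : ℝ, 0 ≤ (∫ l : ℝ, |l| ^ n * ‖F l‖) * (s * s) +
      (2 * ∫ l : ℝ, |l| ^ (n + 1) * ‖F l‖) * s + ∫ l : ℝ, |l| ^ (n + 2) * ‖F l‖ := by
    intro s
    have h1 : 0 ≤ ∫ l : ℝ, |l| ^ n * ‖F l‖ * (s + |l|) ^ 2 :=
      integral_nonneg fun l => by positivity
    have h2 : (fun l : ℝ => |l| ^ n * ‖F l‖ * (s + |l|) ^ 2) = fun l => |l| ^ n * ‖F l‖ * (s * s) +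
        2 * s * (|l| ^ (n + 1) * ‖F l‖) + |l| ^ (n + 2) * ‖F l‖ := by
      ext l; ring
    have h3 : Integrable fun l : ℝ => |l| ^ n * ‖F l‖ * (s * s) +
        2 * s * (|l| ^ (n + 1) * ‖F l‖) := ((hint n).mul_const _).add ((hint (n + 1)).const_mul _)
    rw [h2, integral_add h3 (hint (n + 2)),
      integral_add ((hint n).mul_const _) ((hint (n + 1)).const_mul _), integral_mul_const,
      integral_const_mul] at h1
    linarith
  have := discrim_le_zero hq
  rw [discrim] at this
  linarith

/-- The Denjoy–Carleman theorem applied to the Fourier integral of `F`. The parameter `σ` serves to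
cover both directions on the line, by `σ = 1` and `σ = -1`. -/
theorem integral_exp_eq_zero_of_moments (F : ℝ → ℂ) (hF : AEStronglyMeasurable F)
    (hint : ∀ n : ℕ, Integrable fun l : ℝ => |l| ^ n * ‖F l‖)
    (hpos : ∀ n : ℕ, 0 < ∫ l : ℝ, |l| ^ n * ‖F l‖)
    (hzero : ∀ n : ℕ, ∫ l : ℝ, (l : ℂ) ^ n * F l = 0)
    (hdiv : ¬ Summable fun n : ℕ => (∫ l : ℝ, |l| ^ (n + 1) * ‖F l‖) ^ (-(1 / ((n : ℝ) + 1))))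
    (σ : ℝ) (hσ : |σ| ≤ 1) (t : ℝ) (ht : 0 ≤ t) :
    ∫ l : ℝ, Complex.exp (t * ((σ * l : ℝ) * Complex.I)) * F l = 0 := by
  set G : ℕ → ℝ → ℂ := fun n x =>
    ∫ l : ℝ, ((σ * l : ℝ) * Complex.I) ^ n * Complex.exp (x * ((σ * l : ℝ) * Complex.I)) * F l
    with hG
  have hle : ∀ l : ℝ, |σ * l| ≤ |l| := fun l => by
    rw [abs_mul]; exact mul_le_of_le_one_left (abs_nonneg _) hσ
  have hexp : ∀ x l : ℝ, ‖Complex.exp (x * ((σ * l : ℝ) * Complex.I))‖ = 1 := fun x l => by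
    rw [← mul_assoc, ← Complex.ofReal_mul, Complex.norm_exp_ofReal_mul_I]
  have hnorm : ∀ (n : ℕ) (x l : ℝ), ‖((σ * l : ℝ) * Complex.I) ^ n *
      Complex.exp (x * ((σ * l : ℝ) * Complex.I)) * F l‖ ≤ |l| ^ n * ‖F l‖ := by
    intro n x l
    rw [norm_mul, norm_mul, hexp, mul_one, norm_pow, norm_mul, Complex.norm_I, mul_one,
      Complex.norm_real, Real.norm_eq_abs]
    exact mul_le_mul_of_nonneg_right (pow_le_pow_left₀ (abs_nonneg _) (hle l) n) (norm_nonneg _)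
  have hGint : ∀ (n : ℕ) (x : ℝ), Integrable fun l : ℝ => ((σ * l : ℝ) * Complex.I) ^ n *
      Complex.exp (x * ((σ * l : ℝ) * Complex.I)) * F l := fun n x =>
    (hint n).mono' ((Continuous.aestronglyMeasurable (by fun_prop)).mul hF)
      (.of_forall fun l => hnorm n x l)
  have hmain := eq_zero_of_flat_of_not_summable G (fun n => ∫ l : ℝ, |l| ^ n * ‖F l‖) hpos
    (antitone_moment_ratio F hint hpos)
    (fun n x => norm_integral_le_of_norm_le (hint n) (.of_forall fun l => hnorm n x l)) ?_
    (not_summable_ratio_of_not_summable_rpow _ hpos hdiv) ?_ t ht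
  · simpa [hG] using hmain
  · intro n m x h hh
    have hsplit : G n (x + h) - ∑ i ∈ Finset.range m, ((h ^ i / i.factorial : ℝ) : ℂ) * G (n + i) x
        = ∫ l : ℝ, ((σ * l : ℝ) * Complex.I) ^ n * Complex.exp (x * ((σ * l : ℝ) * Complex.I)) *
          F l * (Complex.exp (h * ((σ * l : ℝ) * Complex.I)) -
            ∑ i ∈ Finset.range m, (h * ((σ * l : ℝ) * Complex.I)) ^ i / (i.factorial : ℂ)) := by
      simp only [hG, ← integral_const_mul]
      rw [← integral_finsetSum _ fun i _ => (hGint (n + i) x).const_mul _,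
        ← integral_sub (hGint n (x + h))
          (integrable_finsetSum _ fun i _ => (hGint (n + i) x).const_mul _)]
      refine integral_congr_ae (.of_forall fun l => ?_)
      simp only
      rw [mul_sub, Finset.mul_sum]
      congr 1
      · rw [Complex.ofReal_add, add_mul, Complex.exp_add]; ring
      · refine Finset.sum_congr rfl fun i _ => ?_
        push_cast
        ring
    rw [hsplit, ← integral_mul_const]
    refine norm_integral_le_of_norm_le ((hint (n + m)).mul_const _) (.of_forall fun l => ?_)
    rw [norm_mul]
    have hrem : ‖Complex.exp (h * ((σ * l : ℝ) * Complex.I)) -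
        ∑ i ∈ Finset.range m, (h * ((σ * l : ℝ) * Complex.I)) ^ i / (i.factorial : ℂ)‖ ≤
          (h * |l|) ^ m / m.factorial := by
      -- The signs of `σ` and `l` are absorbed by the parameter of the remainder estimate.
      rcases eq_or_ne l 0 with rfl | hl
      · have := norm_exp_mul_I_sub_sum_le m (h * |0|) (by simp) 0 (by simp)
        simpa using this
      · have hl' : |l| ≠ 0 := abs_ne_zero.2 hl
        have := norm_exp_mul_I_sub_sum_le m (h * |l|) (by positivity) (σ * l / |l|)
          (by rw [abs_div, abs_abs, div_le_one (abs_pos.2 hl)]; exact hle l)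
        have he : (h : ℂ) * ((σ * l : ℝ) * Complex.I) =
            (h * |l| : ℝ) * ((σ * l / |l| : ℝ) * Complex.I) := by
          have : ((|l| : ℝ) : ℂ) ≠ 0 := by exact_mod_cast hl'
          push_cast
          field_simp
        rwa [he]
    calc _ ≤ |l| ^ n * ‖F l‖ * ((h * |l|) ^ m / m.factorial) := by
          gcongr
          exact hnorm n x l
      _ = _ := by rw [pow_add, mul_pow]; ring
  · intro n
    have : G n 0 = (σ * Complex.I) ^ n * ∫ l : ℝ, (l : ℂ) ^ n * F l := by
      rw [← integral_const_mul]
      refine integral_congr_ae (.of_forall fun l => ?_)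
      simp only [Complex.ofReal_zero, zero_mul, Complex.exp_zero, Complex.ofReal_mul]
      ring
    rw [this, hzero, mul_zero]

/-- A function all of whose moments vanish is zero if its absolute moments satisfy Carleman's
condition. That condition is needed only where the absolute moments are positive: in Lean a negative
real power of `0` is `0`, so that it would fail for `F = 0`. -/
theorem ae_eq_zero_of_moments_eq_zero (F : ℝ → ℂ) (hF : AEStronglyMeasurable F)
    (hint : ∀ n : ℕ, Integrable fun l : ℝ => |l| ^ n * ‖F l‖)
    (hzero : ∀ n : ℕ, ∫ l : ℝ, (l : ℂ) ^ n * F l = 0)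
    (hdiv : (∀ n : ℕ, 0 < ∫ l : ℝ, |l| ^ n * ‖F l‖) →
      ¬ Summable fun n : ℕ => (∫ l : ℝ, |l| ^ (n + 1) * ‖F l‖) ^ (-(1 / ((n : ℝ) + 1)))) :
    F =ᵐ[volume] 0 := by
  by_cases hpos : ∀ n : ℕ, 0 < ∫ l : ℝ, |l| ^ n * ‖F l‖
  · have hF1 : Integrable F := by
      rw [← integrable_norm_iff hF]
      simpa using hint 0
    refine ae_eq_zero_of_integral_exp_eq_zero F hF1 fun t => ?_
    rcases le_total 0 t with ht | ht
    · simpa using integral_exp_eq_zero_of_moments F hF hint hpos hzero (hdiv hpos) 1 (by simp) t ht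
    · simpa using integral_exp_eq_zero_of_moments F hF hint hpos hzero (hdiv hpos) (-1) (by simp) (-t)
        (by linarith)
  · push Not at hpos
    obtain ⟨n, hn⟩ := hpos
    have h0 : ∫ l : ℝ, |l| ^ n * ‖F l‖ = 0 :=
      le_antisymm hn (integral_nonneg fun l => by positivity)
    have h1 := (integral_eq_zero_iff_of_nonneg (fun l => by positivity) (hint n)).1 h0
    filter_upwards [h1, Measure.ae_ne volume 0] with l hl hl0
    have := abs_pos.2 hl0
    simpa [hl0] using hl

/-! ### The two measures and the differential expression -/

theorem halfLineMeasure_absolutelyContinuous (w : ℝ → ℝ) :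
    halfLineMeasure w ≪ volume.restrict (Ioi 0) :=
  withDensity_absolutelyContinuous _ _

theorem ae_halfLineMeasure_pos (w : ℝ → ℝ) : ∀ᵐ r ∂halfLineMeasure w, 0 < r :=
  (halfLineMeasure_absolutelyContinuous w).ae_le (ae_restrict_mem measurableSet_Ioi)

theorem ae_lineMeasure_iff {wt : ℝ → ℝ} (hwt_meas : Measurable wt)
    (hwt_pos : ∀ l, l ≠ 0 → 0 < wt l) (p : ℝ → Prop) :
    (∀ᵐ l ∂lineMeasure wt, p l) ↔ ∀ᵐ l, p l := by
  rw [lineMeasure, ae_withDensity_iff hwt_meas.ennreal_ofReal]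
  constructor
  · intro h
    filter_upwards [h, Measure.ae_ne volume 0] with l hl hl0
    exact hl (by simpa using hwt_pos l hl0)
  · intro h
    filter_upwards [h] with l hl _
    exact hl

theorem diffOp_eventuallyEq (n : ℕ) (a : ℕ → ℝ → ℂ) {u v : ℝ → ℂ} {r : ℝ} (h : u =ᶠ[𝓝 r] v) :
    diffOp n a u =ᶠ[𝓝 r] diffOp n a v := by
  filter_upwards [h.eventuallyEq_nhds] with x hx
  exact Finset.sum_congr rfl fun k _ => by rw [hx.iteratedDeriv_eq k]

theorem diffOp_zero (n : ℕ) (a : ℕ → ℝ → ℂ) : diffOp n a 0 = 0 := by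
  ext r
  refine Finset.sum_eq_zero fun k _ => ?_
  simp

theorem diffOp_eq_zero_of_gt (n : ℕ) (a : ℕ → ℝ → ℂ) {u : ℝ → ℂ} {R : ℝ}
    (hR : ∀ r > R, u r = 0) : ∀ r > R, diffOp n a u r = 0 := fun r hr => by
  have : u =ᶠ[𝓝 r] 0 := by
    filter_upwards [Ioi_mem_nhds hr] with y hy using hR y hy
  rw [(diffOp_eventuallyEq n a this).eq_of_nhds, diffOp_zero]
  rfl

theorem tsupport_diffOp_subset (n : ℕ) (a : ℕ → ℝ → ℂ) (φ : ℝ → ℂ) :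
    tsupport (diffOp n a φ) ⊆ tsupport φ := by
  intro x hx
  contrapose! hx
  rw [notMem_tsupport_iff_eventuallyEq] at hx ⊢
  simpa [diffOp_zero] using diffOp_eventuallyEq n a hx

/-- The coefficients need be smooth on `(0, ∞)` only, since `φ` vanishes near `(-∞, 0]`. -/
theorem IsTestFunction.diffOp {n : ℕ} {a : ℕ → ℝ → ℂ} (ha : ∀ k, ContDiffOn ℝ ∞ (a k) (Ioi 0))
    {φ : ℝ → ℂ} (hφ : IsTestFunction φ) : IsTestFunction (diffOp n a φ) := by
  have hts := tsupport_diffOp_subset n a φ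
  refine ⟨contDiff_iff_contDiffAt.2 fun x => ?_, hφ.2.1.mono' (subset_closure.trans hts),
    hts.trans hφ.2.2⟩
  by_cases hx : x ∈ tsupport φ
  · have hx0 : Ioi (0 : ℝ) ∈ 𝓝 x := Ioi_mem_nhds (hφ.2.2 hx)
    refine ContDiffAt.sum fun k _ => ((ha k).contDiffAt hx0).mul ?_
    rw [iteratedDeriv_eq_iterate]
    exact (hφ.1.iterate_deriv k).contDiffAt
  · have : Chernoff.diffOp n a φ =ᶠ[𝓝 x] 0 := by
      rw [← notMem_tsupport_iff_eventuallyEq]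
      exact fun h => hx (hts h)
    exact contDiffAt_const.congr_of_eventuallyEq this

theorem IsTestFunction.iterate_diffOp {n : ℕ} {a : ℕ → ℝ → ℂ}
    (ha : ∀ k, ContDiffOn ℝ ∞ (a k) (Ioi 0)) {φ : ℝ → ℂ} (hφ : IsTestFunction φ) (m : ℕ) :
    IsTestFunction ((Chernoff.diffOp n a)^[m] φ) ∧
      tsupport ((Chernoff.diffOp n a)^[m] φ) ⊆ tsupport φ := by
  induction m with
  | zero => exact ⟨hφ, Subset.rfl⟩
  | succ m ih =>
    rw [Function.iterate_succ_apply']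
    exact ⟨ih.1.diffOp ha, (tsupport_diffOp_subset n a _).trans ih.2⟩

/-! ### Local finiteness of the measure on the half-line -/

theorem exists_isTestFunction_eq_one {x y : ℝ} (hx : 0 < x) (hxy : x < y) :
    ∃ φ : ℝ → ℂ, IsTestFunction φ ∧ ∀ r ∈ Icc x y, φ r = 1 := by
  let b : ContDiffBump ((x + y) / 2) := ⟨(y - x) / 2, y / 2, by linarith, by linarith⟩
  have hts : tsupport (fun r => (b r : ℂ)) ⊆ tsupport b := by
    refine closure_mono fun r hr => ?_
    simpa using hr
  refine ⟨fun r => (b r : ℂ), ⟨Complex.ofRealCLM.contDiff.comp b.contDiff,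
    b.hasCompactSupport.mono' (subset_closure.trans hts), hts.trans ?_⟩, fun r hr => ?_⟩
  · rw [b.tsupport_eq, Real.closedBall_eq_Icc]
    intro r hr
    have := hr.1
    simp only [b, mem_Ioi] at this ⊢
    linarith
  · have : b r = 1 := b.one_of_mem_closedBall (by
      rw [Real.closedBall_eq_Icc]
      simp only [b]
      constructor <;> linarith [hr.1, hr.2])
    simp [this]

theorem measure_lt_top_of_le_norm {μ : Measure ℝ} {u : ℝ → ℂ} (hu : MemLp u 2 μ) {ε : ℝ}
    (hε : 0 < ε) {s : Set ℝ} (hs : ∀ r ∈ s, ε ≤ ‖u r‖) : μ s < ⊤ := by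
  have h := hu.meas_ge_lt_top two_ne_zero (by simp) (ε := ε.toNNReal) (by simpa using hε)
  refine (measure_mono fun r hr => ?_).trans_lt h
  have := hs r hr
  simp only [mem_ofPred_eq]
  rw [Real.toNNReal_le_iff_le_coe, coe_nnnorm]
  exact this

/-- The weight is integrable near `0` because a member of `D` that agrees there with `v` is square
integrable and bounded away from `0`, and it is locally integrable on `(0, ∞)` because test functions
are square integrable. -/
theorem halfLineMeasure_Ioo_lt_top {w : ℝ → ℝ} {n : ℕ} {a : ℕ → ℝ → ℂ}
    {D : Submodule ℂ (ℝ → ℂ)} (hD : IsInitialDomain w n a D) {v : ℝ → ℂ} (hv : IsLocallyIn D v)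
    (hvc : ContinuousOn v (Ici 0)) (hv0 : v 0 = 1) (R : ℝ) : halfLineMeasure w (Ioo 0 R) < ⊤ := by
  have h1 : ∀ᶠ r in 𝓝[Ici 0] (0 : ℝ), (1 / 2 : ℝ) < ‖v r‖ := by
    have := (hvc 0 self_mem_Ici).norm
    exact this.eventually (lt_mem_nhds (by simp only [hv0]; norm_num))
  obtain ⟨ε, hε, h2⟩ := Metric.mem_nhdsWithin_iff.1 h1
  obtain ⟨u, hu, huv⟩ := hv ε
  have h3 : halfLineMeasure w (Ioo 0 ε) < ⊤ :=
    measure_lt_top_of_le_norm (hD.memLp u hu) (ε := 1 / 2) (by norm_num) fun r hr => by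
      rw [huv r hr]
      have : r ∈ Metric.ball 0 ε ∩ Ici 0 := by
        simp [abs_of_pos hr.1, hr.2, hr.1.le]
      exact (h2 this).le
  rcases le_or_gt R (ε / 2) with hR | hR
  · exact (measure_mono (Ioo_subset_Ioo_right (by linarith))).trans_lt h3
  · obtain ⟨φ, hφ, hφ1⟩ := exists_isTestFunction_eq_one (half_pos hε) hR
    have h4 : halfLineMeasure w (Icc (ε / 2) R) < ⊤ :=
      measure_lt_top_of_le_norm (hD.memLp φ (hD.test_mem φ hφ)) one_pos fun r hr => by
        rw [hφ1 r hr, norm_one]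
    refine (measure_mono fun r hr => ?_).trans_lt (measure_union_lt_top h3 h4)
    rcases lt_or_ge r ε with h | h
    · exact .inl ⟨hr.1, h⟩
    · exact .inr ⟨by linarith, hr.2.le⟩

theorem halfLineMeasure_Ioo_pos {w : ℝ → ℝ} (hw_meas : Measurable w)
    (hw_pos : ∀ r, 0 < r → 0 < w r) {ε : ℝ} (hε : 0 < ε) : 0 < halfLineMeasure w (Ioo 0 ε) := by
  rw [pos_iff_ne_zero]
  intro h
  rw [halfLineMeasure, withDensity_apply _ measurableSet_Ioo,
    Measure.restrict_restrict measurableSet_Ioo,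
    lintegral_eq_zero_iff hw_meas.ennreal_ofReal,
    inter_eq_left.2 Ioo_subset_Ioi_self] at h
  have h2 : ∀ᵐ r ∂volume.restrict (Ioo (0 : ℝ) ε), False := by
    filter_upwards [h, ae_restrict_mem measurableSet_Ioo] with r hr hr'
    have := hw_pos r hr'.1
    simp only [Pi.zero_apply, ENNReal.ofReal_eq_zero] at hr
    linarith
  rw [ae_iff] at h2
  simp at h2
  linarith

theorem integrable_of_memLp_of_eqOn_zero {w : ℝ → ℝ} {R : ℝ}
    (hfin : halfLineMeasure w (Ioo 0 R) < ⊤) {u : ℝ → ℂ} (hu : MemLp u 2 (halfLineMeasure w))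
    (hzero : ∀ᵐ r ∂halfLineMeasure w, R ≤ r → u r = 0) : Integrable u (halfLineMeasure w) := by
  have : IsFiniteMeasure ((halfLineMeasure w).restrict (Ioo 0 R)) := ⟨by simpa using hfin⟩
  have h1 : IntegrableOn u (Ioo 0 R) (halfLineMeasure w) :=
    (hu.restrict _).integrable (by norm_num)
  refine h1.integrable_of_ae_notMem_eq_zero ?_
  filter_upwards [hzero, ae_halfLineMeasure_pos w] with r hr h0 hr'
  exact hr (not_lt.1 fun h => hr' ⟨h0, h⟩)

/-! ### Powers of the operator applied to a function that vanishes near the origin -/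

/-- A differential expression does not enlarge supports: `L^m f` vanishes on `(0, η)` if `f` does. -/
theorem IsPower.ae_eq_zero {w : ℝ → ℝ} {n : ℕ} {a : ℕ → ℝ → ℂ}
    (ha : ∀ k, ContDiffOn ℝ ∞ (a k) (Ioi 0)) {m : ℕ} {f g : HalfLineL2 w}
    (hg : IsPower w n a m f g) (hfin : ∀ R, halfLineMeasure w (Ioo 0 R) < ⊤) {η : ℝ}
    (hf : ∀ᵐ r ∂halfLineMeasure w, r < η → f r = 0) :
    ∀ᵐ r ∂halfLineMeasure w, r < η → g r = 0 := by
  have hloc : LocallyIntegrableOn g (Ioo 0 η) (halfLineMeasure w) := by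
    have : IsFiniteMeasure ((halfLineMeasure w).restrict (Ioo 0 η)) := ⟨by simpa using hfin η⟩
    have : IntegrableOn g (Ioo 0 η) (halfLineMeasure w) :=
      ((Lp.memLp g).restrict _).integrable (by norm_num)
    exact this.locallyIntegrableOn
  have h := isOpen_Ioo.ae_eq_zero_of_integral_contDiff_smul_eq_zero hloc fun φ hφ hc hs => by
    have hts : tsupport (fun r => (φ r : ℂ)) ⊆ tsupport φ := by
      refine closure_mono fun r hr => ?_
      simpa using hr
    have hφt : IsTestFunction fun r => (φ r : ℂ) := ⟨Complex.ofRealCLM.contDiff.comp hφ,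
      hc.mono' (subset_closure.trans hts), (hts.trans hs).trans fun r hr => hr.1⟩
    have h1 := hg _ hφt
    have h2 : ∫ r, f r * conj ((diffOp n a)^[m] (fun r => (φ r : ℂ)) r) ∂halfLineMeasure w = 0 := by
      refine integral_eq_zero_of_ae ?_
      filter_upwards [hf] with r hr
      rcases lt_or_ge r η with h | h
      · simp [hr h]
      · have : r ∉ tsupport ((diffOp n a)^[m] (fun r => (φ r : ℂ))) := fun hmem =>
          absurd ((hs (hts ((hφt.iterate_diffOp ha m).2 hmem))).2) (not_lt.2 h)
        simp [image_eq_zero_of_notMem_tsupport this]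
    rw [h2] at h1
    rw [h1]
    refine integral_congr_ae (.of_forall fun r => ?_)
    simp [mul_comm]
  filter_upwards [h, ae_halfLineMeasure_pos w] with r hr h0 hη
  exact hr ⟨h0, hη⟩

/-- The members of `D` are cut off near `0`; what remains is a test function. -/
theorem exists_isTestFunction_eqOn {w : ℝ → ℝ} {n : ℕ} {a : ℕ → ℝ → ℂ}
    {D : Submodule ℂ (ℝ → ℂ)} (hD : IsInitialDomain w n a D) {u : ℝ → ℂ} (hu : u ∈ D) {η : ℝ}
    (hη : 0 < η) : ∃ φ : ℝ → ℂ, IsTestFunction φ ∧ EqOn φ u (Ioi (η / 2)) := by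
  set χ : ℝ → ℝ := fun r => Real.smoothTransition (4 * r / η - 1) with hχ
  have hχs : ContDiff ℝ ∞ χ := Real.smoothTransition.contDiff.comp (by fun_prop)
  have hχ0 : ∀ r ≤ η / 4, χ r = 0 := fun r hr => Real.smoothTransition.zero_of_nonpos (by
    rw [sub_nonpos, div_le_one hη]; linarith)
  have hχ1 : ∀ r, η / 2 < r → χ r = 1 := fun r hr => Real.smoothTransition.one_of_one_le (by
    rw [le_sub_iff_add_le, le_div_iff₀ hη]; linarith)
  obtain ⟨R, hR⟩ := hD.eventually_zero u hu
  have hts : tsupport (fun r => (χ r : ℂ) * u r) ⊆ Icc (η / 4) R := by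
    refine closure_minimal (fun r hr => ?_) isClosed_Icc
    contrapose! hr
    rw [Function.notMem_support]
    rcases le_or_gt r (η / 4) with h | h
    · simp [hχ0 r h]
    · have : R < r := not_le.1 fun h' => hr ⟨h.le, h'⟩
      simp [hR r this]
  refine ⟨fun r => (χ r : ℂ) * u r, ⟨?_, isCompact_Icc.of_isClosed_subset (isClosed_tsupport _) hts,
    hts.trans fun r hr => lt_of_lt_of_le (by positivity) hr.1⟩, fun r hr => ?_⟩
  · refine contDiff_iff_contDiffAt.2 fun x => ?_
    rcases lt_or_ge x (η / 4) with hx | hx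
    · refine contDiffAt_const (c := (0 : ℂ)) |>.congr_of_eventuallyEq ?_
      filter_upwards [Iio_mem_nhds hx] with r hr
      simp [hχ0 r (mem_Iio.1 hr).le]
    · exact (Complex.ofRealCLM.contDiff.comp hχs).contDiffAt.mul
        ((hD.contDiffOn u hu).contDiffAt (Ioi_mem_nhds (by linarith)))
  · simp [hχ1 r hr]

/-- If `f` and `g = L f` (in the sense of distributions) vanish near `0`, then `f` is in the domain of
the self-adjoint closure `A` of `L`, and `A f = g`. By `exists_isTestFunction_eqOn` test functions
are as good as members of `D` in a pairing with `f` or `g`, so that `f` is in the domain of the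
adjoint of `A`. -/
theorem mem_graph_of_ae_eq_zero {w : ℝ → ℝ} {n : ℕ} {a : ℕ → ℝ → ℂ} {D : Submodule ℂ (ℝ → ℂ)}
    (hD : IsInitialDomain w n a D) {A : HalfLineL2 w →ₗ.[ℂ] HalfLineL2 w} (hA : IsSelfAdjoint A)
    (hgraph : (A.graph : Set (HalfLineL2 w × HalfLineL2 w)) =
      closure {p | ∃ u ∈ D, p.1 =ᵐ[halfLineMeasure w] u ∧
        p.2 =ᵐ[halfLineMeasure w] diffOp n a u}) {f g : HalfLineL2 w}
    (hfg : ∀ φ, IsTestFunction φ → ∫ r, f r * conj (diffOp n a φ r) ∂halfLineMeasure w =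
      ∫ r, g r * conj (φ r) ∂halfLineMeasure w) {η : ℝ} (hη : 0 < η)
    (hf : ∀ᵐ r ∂halfLineMeasure w, r < η → f r = 0)
    (hg : ∀ᵐ r ∂halfLineMeasure w, r < η → g r = 0) : (f, g) ∈ A.graph := by
  have key : ∀ p ∈ A.graph, inner ℂ g p.1 = inner ℂ f p.2 := by
    have hcl : IsClosed {p : HalfLineL2 w × HalfLineL2 w | inner ℂ g p.1 = inner ℂ f p.2} :=
      isClosed_eq (by fun_prop) (by fun_prop)
    intro p hp
    have hp' : p ∈ closure _ := hgraph ▸ (show p ∈ (A.graph : Set _) from hp)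
    refine closure_minimal ?_ hcl hp'
    rintro ⟨p, q⟩ ⟨u, hu, hpu, hqu⟩
    obtain ⟨φ, hφ, hφu⟩ := exists_isTestFunction_eqOn hD hu hη
    have h1 := congrArg conj (hfg φ hφ)
    rw [← integral_conj, ← integral_conj] at h1
    simp only [map_mul, Complex.conj_conj] at h1
    simp only [mem_ofPred_eq, L2.inner_def, RCLike.inner_apply]
    calc ∫ r, p r * conj (g r) ∂halfLineMeasure w
        = ∫ r, conj (g r) * φ r ∂halfLineMeasure w := by
          refine integral_congr_ae ?_
          filter_upwards [hpu, hg] with r hr hr'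
          rcases lt_or_ge r η with h | h
          · simp [hr' h]
          · rw [hr, hφu (by simp only [mem_Ioi]; linarith), mul_comm]
      _ = ∫ r, conj (f r) * diffOp n a φ r ∂halfLineMeasure w := h1.symm
      _ = ∫ r, q r * conj (f r) ∂halfLineMeasure w := by
          refine integral_congr_ae ?_
          filter_upwards [hqu, hf] with r hr hr'
          rcases lt_or_ge r η with h | h
          · simp [hr' h]
          · have : diffOp n a φ r = diffOp n a u r :=
              (diffOp_eventuallyEq n a (hφu.eventuallyEq_of_mem
                (Ioi_mem_nhds (by linarith)))).eq_of_nhds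
            rw [hr, this, mul_comm]
  have hex : ∀ x : A.domain, inner ℂ g (x : HalfLineL2 w) = inner ℂ f (A x) := fun x =>
    key _ (A.mem_graph x)
  have hdom : f ∈ A.adjoint.domain := LinearPMap.mem_adjoint_domain_of_exists f ⟨g, hex⟩
  have happ := LinearPMap.adjoint_apply_eq hA.dense_domain ⟨f, hdom⟩ hex
  have : (f, g) ∈ A.adjoint.graph := by
    rw [← happ]
    exact A.adjoint.mem_graph ⟨f, hdom⟩
  rwa [LinearPMap.isSelfAdjoint_def.1 hA] at this

/-! ### Closed almost everywhere relations in `L²` -/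

theorem exists_subseq_tendsto_ae {α : Type*} [MeasurableSpace α] {μ : Measure α}
    {u : ℕ → Lp ℂ 2 μ} {v : Lp ℂ 2 μ} (h : Tendsto u atTop (𝓝 v)) :
    ∃ s : ℕ → ℕ, StrictMono s ∧ ∀ᵐ x ∂μ, Tendsto (fun i => u (s i) x) atTop (𝓝 (v x)) :=
  (tendstoInMeasure_of_tendsto_Lp h).exists_seq_tendsto_ae

theorem isClosed_setOf_ae_eq_mul {α : Type*} [MeasurableSpace α] {μ : Measure α} (x : α → ℂ) :
    IsClosed {p : Lp ℂ 2 μ × Lp ℂ 2 μ | ∀ᵐ l ∂μ, p.2 l = x l * p.1 l} := by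
  refine IsSeqClosed.isClosed fun u p hu hp => ?_
  obtain ⟨s, hs, h1⟩ := exists_subseq_tendsto_ae ((continuous_fst.tendsto p).comp hp)
  obtain ⟨t, ht, h2⟩ := exists_subseq_tendsto_ae
    (((continuous_snd.tendsto p).comp hp).comp hs.tendsto_atTop)
  have hall := ae_all_iff.2 fun i => hu (s (t i))
  filter_upwards [h1, h2, hall] with l hl1 hl2 hl
  refine tendsto_nhds_unique hl2 ?_
  refine ((hl1.comp ht.tendsto_atTop).const_mul (x l)).congr fun i => ?_
  exact (hl i).symm

theorem isClosed_setOf_ae_even {wt : ℝ → ℝ} (hwt_meas : Measurable wt)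
    (hwt_pos : ∀ l, l ≠ 0 → 0 < wt l) :
    IsClosed {p : LineL2 wt | ∀ᵐ l, p (-l) = p l} := by
  refine IsSeqClosed.isClosed fun u p hu hp => ?_
  obtain ⟨s, -, h1⟩ := exists_subseq_tendsto_ae hp
  rw [ae_lineMeasure_iff hwt_meas hwt_pos] at h1
  have h2 := (Measure.measurePreserving_neg (volume : Measure ℝ)).quasiMeasurePreserving.ae h1
  have hall := ae_all_iff.2 fun i => hu (s i)
  filter_upwards [h1, h2, hall] with l hl1 hl2 hl
  exact tendsto_nhds_unique hl2 (hl1.congr fun i => (hl i).symm)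

/-! ### The conjugate transform -/

/-- The transform `f ↦ conj (T (conj f))`, which integrates `f` against `conj (ψ_λ)` instead of
`ψ_λ`. -/
noncomputable def conjTransform {w wt : ℝ → ℝ} (T : HalfLineL2 w →ₗ[ℂ] LineL2 wt) :
    HalfLineL2 w →ₗ[ℂ] LineL2 wt where
  toFun f := star (T (star f))
  map_add' f g := by
    have : star (f + g) = star f + star g := by
      refine Lp.ext ?_
      filter_upwards [Lp.coeFn_star (f + g), Lp.coeFn_star f, Lp.coeFn_star g, Lp.coeFn_add f g,
        Lp.coeFn_add (star f) (star g)] with r h1 h2 h3 h4 h5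
      rw [h1, Pi.star_apply, h4, h5, Pi.add_apply, Pi.add_apply, h2, h3, Pi.star_apply,
        Pi.star_apply, star_add]
    rw [this, map_add]
    refine Lp.ext ?_
    filter_upwards [Lp.coeFn_star (T (star f) + T (star g)), Lp.coeFn_star (T (star f)),
      Lp.coeFn_star (T (star g)), Lp.coeFn_add (T (star f)) (T (star g)),
      Lp.coeFn_add (star (T (star f))) (star (T (star g)))] with r h1 h2 h3 h4 h5
    rw [h1, Pi.star_apply, h4, h5, Pi.add_apply, Pi.add_apply, h2, h3, Pi.star_apply,
      Pi.star_apply, star_add]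
  map_smul' c f := by
    have : star (c • f) = conj c • star f := by
      refine Lp.ext ?_
      filter_upwards [Lp.coeFn_star (c • f), Lp.coeFn_star f, Lp.coeFn_smul c f,
        Lp.coeFn_smul (conj c) (star f)] with r h1 h2 h3 h4
      simp [h1, h2, h3, h4]
    rw [this, map_smul]
    refine Lp.ext ?_
    filter_upwards [Lp.coeFn_star (conj c • T (star f)), Lp.coeFn_star (T (star f)),
      Lp.coeFn_smul (conj c) (T (star f)), Lp.coeFn_smul c (star (T (star f)))] with r h1 h2 h3 h4
    simp [h1, h2, h3, h4]

theorem norm_star_Lp {α : Type*} [MeasurableSpace α] {μ : Measure α} (f : Lp ℂ 2 μ) :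
    ‖star f‖ = ‖f‖ := by
  have h : ∀ᵐ x ∂μ, ‖(star f : Lp ℂ 2 μ) x‖ = ‖f x‖ := by
    filter_upwards [Lp.coeFn_star f] with r hr
    simp [hr]
  exact le_antisymm (Lp.norm_le_norm_of_ae_le (h.mono fun _ hr => hr.le))
    (Lp.norm_le_norm_of_ae_le (h.mono fun _ hr => hr.ge))

theorem norm_sq_eq_integral {wt : ℝ → ℝ} (h : LineL2 wt) :
    ‖h‖ ^ 2 = ∫ l, ‖h l‖ ^ 2 ∂lineMeasure wt := by
  have h1 := norm_sq_eq_re_inner (𝕜 := ℂ) h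
  rw [L2.inner_def] at h1
  have h2 : (fun l => inner ℂ (h l) (h l)) = fun l => ((‖h l‖ ^ 2 : ℝ) : ℂ) := by
    ext l; simp
  rw [h2, integral_complex_ofReal] at h1
  simpa using h1

theorem norm_sq_conjTransform {w wt : ℝ → ℝ} {c : ℝ} {T : HalfLineL2 w →ₗ[ℂ] LineL2 wt}
    (hT : PlancherelFormula w wt c T) (f : HalfLineL2 w) :
    ‖f‖ ^ 2 = c * ‖conjTransform T f‖ ^ 2 := by
  change _ = c * ‖star (T (star f))‖ ^ 2
  rw [norm_star_Lp, norm_sq_eq_integral, ← hT, norm_star_Lp]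

theorem norm_conjTransform_le {w wt : ℝ → ℝ} {c : ℝ} (hc : 0 < c)
    {T : HalfLineL2 w →ₗ[ℂ] LineL2 wt} (hT : PlancherelFormula w wt c T) (f : HalfLineL2 w) :
    ‖conjTransform T f‖ ≤ (√c)⁻¹ * ‖f‖ := by
  rw [inv_mul_eq_div, le_div_iff₀ (Real.sqrt_pos.2 hc)]
  refine abs_le_of_sq_le_sq' ?_ (norm_nonneg _) |>.2
  rw [mul_pow, Real.sq_sqrt hc.le, norm_sq_conjTransform hT f, mul_comm]

theorem continuous_conjTransform {w wt : ℝ → ℝ} {c : ℝ} (hc : 0 < c)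
    {T : HalfLineL2 w →ₗ[ℂ] LineL2 wt} (hT : PlancherelFormula w wt c T) :
    Continuous (conjTransform T) :=
  AddMonoidHomClass.continuous_of_bound (conjTransform T) (√c)⁻¹ (norm_conjTransform_le hc hT)

theorem inner_conjTransform {w wt : ℝ → ℝ} {c : ℝ} (hc : 0 < c)
    {T : HalfLineL2 w →ₗ[ℂ] LineL2 wt} (hT : PlancherelFormula w wt c T) (f g : HalfLineL2 w) :
    inner ℂ f g = c * inner ℂ (conjTransform T f) (conjTransform T g) := by
  have h1 : ∀ f, ‖((√c : ℂ) • conjTransform T) f‖ = ‖f‖ := by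
    intro f
    rw [← sq_eq_sq₀ (norm_nonneg _) (norm_nonneg _), norm_sq_conjTransform hT f,
      LinearMap.smul_apply, norm_smul, mul_pow, Complex.norm_real,
      Real.norm_of_nonneg (Real.sqrt_nonneg _), Real.sq_sqrt hc.le]
  have h2 := LinearIsometry.inner_map_map
    (⟨(√c : ℂ) • conjTransform T, h1⟩ : HalfLineL2 w →ₗᵢ[ℂ] LineL2 wt) f g
  rw [← h2]
  change inner ℂ ((√c : ℂ) • conjTransform T f) ((√c : ℂ) • conjTransform T g) = _
  rw [inner_smul_left, inner_smul_right, Complex.conj_ofReal, ← mul_assoc, ← Complex.ofReal_mul,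
    Real.mul_self_sqrt hc.le]

theorem conjTransform_ae_eq {w wt : ℝ → ℝ} {ψ : ℝ → ℝ → ℂ} {T : HalfLineL2 w →ₗ[ℂ] LineL2 wt}
    (hT : IsEigenfunctionTransform w wt ψ T) {f : HalfLineL2 w}
    (hf : Integrable f (halfLineMeasure w)) : conjTransform T f =ᵐ[lineMeasure wt]
      fun l => ∫ r, f r * conj (ψ l r) ∂halfLineMeasure w := by
  have hint : Integrable (star f : HalfLineL2 w) (halfLineMeasure w) := by
    refine hf.congr' (Lp.aestronglyMeasurable _) ?_
    filter_upwards [Lp.coeFn_star f] with r hr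
    simp [hr]
  filter_upwards [Lp.coeFn_star (T (star f)), hT _ hint] with l h1 h2
  change (star (T (star f)) : LineL2 wt) l = _
  rw [h1, Pi.star_apply, h2, RCLike.star_def, ← integral_conj]
  refine integral_congr_ae ?_
  filter_upwards [Lp.coeFn_star f] with r hr
  simp [hr]

/-- For integrable `f` this is plain from `ψ_{-λ} = ψ_λ`; the general case follows by density. -/
theorem conjTransform_even {w wt : ℝ → ℝ} (hwt_meas : Measurable wt)
    (hwt_pos : ∀ l, l ≠ 0 → 0 < wt l) {c : ℝ} (hc : 0 < c) {ψ : ℝ → ℝ → ℂ}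
    (hψ_even : ∀ l r, ψ (-l) r = ψ l r) {T : HalfLineL2 w →ₗ[ℂ] LineL2 wt}
    (hT : IsEigenfunctionTransform w wt ψ T) (hplanch : PlancherelFormula w wt c T)
    (f : HalfLineL2 w) : ∀ᵐ l, conjTransform T f (-l) = conjTransform T f l := by
  induction f using Lp.induction (by simp : (2 : ℝ≥0∞) ≠ ⊤) with
  | indicatorConst b hs hμs =>
    have hint : Integrable (Lp.simpleFunc.indicatorConst 2 hs hμs.ne b : HalfLineL2 w)
        (halfLineMeasure w) := by
      rw [Lp.simpleFunc.coe_indicatorConst]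
      refine Integrable.congr ?_ indicatorConstLp_coeFn.symm
      exact (integrable_indicator_iff hs).2 (integrableOn_const hμs.ne)
    have h1 := conjTransform_ae_eq hT hint
    rw [Filter.EventuallyEq, ae_lineMeasure_iff hwt_meas hwt_pos] at h1
    have h2 := (Measure.measurePreserving_neg (volume : Measure ℝ)).quasiMeasurePreserving.ae h1
    filter_upwards [h1, h2] with l hl1 hl2
    rw [hl1, hl2]
    simp only [hψ_even]
  | add hf hg _ h1 h2 =>
    rw [map_add]
    have h3 := Lp.coeFn_add (conjTransform T (hf.toLp _)) (conjTransform T (hg.toLp _))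
    rw [Filter.EventuallyEq, ae_lineMeasure_iff hwt_meas hwt_pos] at h3
    have h4 := (Measure.measurePreserving_neg (volume : Measure ℝ)).quasiMeasurePreserving.ae h3
    filter_upwards [h1, h2, h3, h4] with l h1 h2 h3 h4
    rw [h3, h4, Pi.add_apply, Pi.add_apply, h1, h2]
  | isClosed =>
    exact (isClosed_setOf_ae_even hwt_meas hwt_pos).preimage (continuous_conjTransform hc hplanch)

/-! ### Diagonalisation of the operator -/

theorem integral_diffOp_mul_conj {w : ℝ → ℝ} {n : ℕ} {a : ℕ → ℝ → ℂ} {D : Submodule ℂ (ℝ → ℂ)}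
    (hD : IsInitialDomain w n a D) (hL : IsEssentiallySelfAdjoint w n a D) {u v : ℝ → ℂ}
    (hu : u ∈ D) (hv : v ∈ D) : ∫ r, diffOp n a u r * conj (v r) ∂halfLineMeasure w =
      ∫ r, u r * conj (diffOp n a v r) ∂halfLineMeasure w := by
  obtain ⟨A, hA, hgraph⟩ := hL
  have hmem : ∀ u (hu : u ∈ D), ((hD.memLp u hu).toLp u, (hD.memLp_diffOp u hu).toLp _) ∈
      A.graph := by
    intro u hu
    rw [← SetLike.mem_coe, hgraph]
    exact subset_closure ⟨u, hu, (hD.memLp u hu).coeFn_toLp,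
      (hD.memLp_diffOp u hu).coeFn_toLp⟩
  obtain ⟨x, hx1, hx2⟩ := (LinearPMap.mem_graph_iff A).1 (hmem u hu)
  obtain ⟨y, hy1, hy2⟩ := (LinearPMap.mem_graph_iff A).1 (hmem v hv)
  have hfa := LinearPMap.adjoint_isFormalAdjoint hA.dense_domain
  rw [LinearPMap.isSelfAdjoint_def.1 hA] at hfa
  have h := hfa y x
  rw [hx1, hx2, hy1, hy2, L2.inner_def, L2.inner_def] at h
  simp only [RCLike.inner_apply] at h
  have e1 : ∀ {p q : ℝ → ℂ} (hp : MemLp p 2 (halfLineMeasure w))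
      (hq : MemLp q 2 (halfLineMeasure w)),
      ∫ r, (hp.toLp p) r * conj ((hq.toLp q) r) ∂halfLineMeasure w =
        ∫ r, p r * conj (q r) ∂halfLineMeasure w := by
    intro p q hp hq
    refine integral_congr_ae ?_
    filter_upwards [hp.coeFn_toLp, hq.coeFn_toLp] with r h1 h2
    rw [h1, h2]
  rw [e1, e1] at h
  exact h.symm

/-- The eigenfunction `v` itself need not be square integrable; since `u` and `L u` vanish for large
`r`, it may be replaced by a member of `D` that agrees with it on a large interval. -/
theorem integral_diffOp_mul_conj_eigenfunction {w : ℝ → ℝ} {n : ℕ} {a : ℕ → ℝ → ℂ}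
    {D : Submodule ℂ (ℝ → ℂ)} (hD : IsInitialDomain w n a D)
    (hL : IsEssentiallySelfAdjoint w n a D) {v : ℝ → ℂ} (hv : IsLocallyIn D v) {x : ℝ}
    (hx : ∀ r, 0 < r → diffOp n a v r = (x : ℂ) * v r) {u : ℝ → ℂ} (hu : u ∈ D) :
    ∫ r, diffOp n a u r * conj (v r) ∂halfLineMeasure w =
      x * ∫ r, u r * conj (v r) ∂halfLineMeasure w := by
  obtain ⟨R, hR⟩ := hD.eventually_zero u hu
  obtain ⟨v', hv', hvv⟩ := hv (R + 1)
  have hLu := diffOp_eq_zero_of_gt n a hR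
  have hLv : ∀ r ∈ Ioo 0 (R + 1), diffOp n a v' r = x * v r := fun r hr => by
    have : v' =ᶠ[𝓝 r] v := by
      filter_upwards [isOpen_Ioo.mem_nhds hr] with y hy using hvv y hy
    rw [(diffOp_eventuallyEq n a this).eq_of_nhds, hx r hr.1]
  calc ∫ r, diffOp n a u r * conj (v r) ∂halfLineMeasure w
      = ∫ r, diffOp n a u r * conj (v' r) ∂halfLineMeasure w := by
        refine integral_congr_ae ?_
        filter_upwards [ae_halfLineMeasure_pos w] with r hr
        rcases lt_or_ge R r with h | h
        · simp [hLu r h]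
        · rw [hvv r ⟨hr, by linarith⟩]
    _ = ∫ r, u r * conj (diffOp n a v' r) ∂halfLineMeasure w :=
        integral_diffOp_mul_conj hD hL hu hv'
    _ = ∫ r, x * (u r * conj (v r)) ∂halfLineMeasure w := by
        refine integral_congr_ae ?_
        filter_upwards [ae_halfLineMeasure_pos w] with r hr
        rcases lt_or_ge R r with h | h
        · simp [hR r h]
        · rw [hLv r ⟨hr, by linarith⟩, map_mul, Complex.conj_ofReal]
          ring
    _ = _ := integral_const_mul _ _

theorem conjTransform_intertwines {w wt : ℝ → ℝ} {n : ℕ} {a : ℕ → ℝ → ℂ}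
    {D : Submodule ℂ (ℝ → ℂ)} (hD : IsInitialDomain w n a D)
    (hL : IsEssentiallySelfAdjoint w n a D) {ψ : ℝ → ℝ → ℂ} (hψ_local : ∀ l, IsLocallyIn D (ψ l))
    {x : ℝ → ℝ} (hψ_eigen : ∀ l, ∀ r, 0 < r → diffOp n a (ψ l) r = (x l : ℂ) * ψ l r)
    (hfin : ∀ R, halfLineMeasure w (Ioo 0 R) < ⊤) {c : ℝ} (hc : 0 < c)
    {T : HalfLineL2 w →ₗ[ℂ] LineL2 wt} (hT : IsEigenfunctionTransform w wt ψ T)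
    (hplanch : PlancherelFormula w wt c T) {p : HalfLineL2 w × HalfLineL2 w}
    (hp : p ∈ closure {p : HalfLineL2 w × HalfLineL2 w | ∃ u ∈ D, p.1 =ᵐ[halfLineMeasure w] u ∧
      p.2 =ᵐ[halfLineMeasure w] diffOp n a u}) :
    ∀ᵐ l ∂lineMeasure wt, conjTransform T p.2 l = x l * conjTransform T p.1 l := by
  have hcont := continuous_conjTransform hc hplanch
  have hcl := (isClosed_setOf_ae_eq_mul (μ := lineMeasure wt) fun l => (x l : ℂ)).preimage
    ((hcont.comp continuous_fst).prodMk (hcont.comp continuous_snd))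
  refine closure_minimal ?_ hcl hp
  rintro ⟨p, q⟩ ⟨u, hu, hpu, hqu⟩
  obtain ⟨R, hR⟩ := hD.eventually_zero u hu
  have hLu := diffOp_eq_zero_of_gt n a hR
  have hip : Integrable p (halfLineMeasure w) :=
    (integrable_of_memLp_of_eqOn_zero (hfin (R + 1)) (hD.memLp u hu)
      (.of_forall fun r hr => hR r (by linarith))).congr hpu.symm
  have hiq : Integrable q (halfLineMeasure w) :=
    (integrable_of_memLp_of_eqOn_zero (hfin (R + 1)) (hD.memLp_diffOp u hu)
      (.of_forall fun r hr => hLu r (by linarith))).congr hqu.symm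
  filter_upwards [conjTransform_ae_eq hT hip, conjTransform_ae_eq hT hiq] with l h1 h2
  simp only [Function.comp_apply]
  rw [h1, h2]
  have e1 : ∫ r, p r * conj (ψ l r) ∂halfLineMeasure w =
      ∫ r, u r * conj (ψ l r) ∂halfLineMeasure w :=
    integral_congr_ae (by filter_upwards [hpu] with r hr; rw [hr])
  have e2 : ∫ r, q r * conj (ψ l r) ∂halfLineMeasure w =
      ∫ r, diffOp n a u r * conj (ψ l r) ∂halfLineMeasure w :=
    integral_congr_ae (by filter_upwards [hqu] with r hr; rw [hr])
  rw [e1, e2]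
  exact integral_diffOp_mul_conj_eigenfunction hD hL (hψ_local l) (hψ_eigen l) hu

/-! ### Orthogonality on the spectral side -/

theorem ofReal_wt_toReal_smul {wt : ℝ → ℝ} (hwt_pos : ∀ l, l ≠ 0 → 0 < wt l) (G : ℝ → ℂ) :
    (fun l => (ENNReal.ofReal (wt l)).toReal • G l) =ᵐ[volume] fun l => (wt l : ℂ) * G l := by
  filter_upwards [Measure.ae_ne volume 0] with l hl
  rw [ENNReal.toReal_ofReal (hwt_pos l hl).le, Complex.real_smul]

theorem integrable_lineMeasure_iff {wt : ℝ → ℝ} (hwt_meas : Measurable wt)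
    (hwt_pos : ∀ l, l ≠ 0 → 0 < wt l) {G : ℝ → ℂ} :
    Integrable G (lineMeasure wt) ↔ Integrable fun l => (wt l : ℂ) * G l := by
  rw [lineMeasure, integrable_withDensity_iff_integrable_smul' hwt_meas.ennreal_ofReal
    (by simp), integrable_congr (ofReal_wt_toReal_smul hwt_pos G)]

theorem integral_lineMeasure {wt : ℝ → ℝ} (hwt_meas : Measurable wt)
    (hwt_pos : ∀ l, l ≠ 0 → 0 < wt l) (G : ℝ → ℂ) :
    ∫ l, G l ∂lineMeasure wt = ∫ l, (wt l : ℂ) * G l := by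
  rw [lineMeasure, integral_withDensity_eq_integral_toReal_smul hwt_meas.ennreal_ofReal
    (by simp), integral_congr_ae (ofReal_wt_toReal_smul hwt_pos G)]

theorem integral_norm_mul_norm_le {α : Type*} [MeasurableSpace α] {μ : Measure α}
    (f g : Lp ℂ 2 μ) : ∫ l, ‖f l‖ * ‖g l‖ ∂μ ≤ ‖f‖ * ‖g‖ := by
  have hf := (Lp.memLp f).norm
  have hg := (Lp.memLp g).norm
  have h := real_inner_le_norm (hf.toLp _) (hg.toLp _)
  have e : ∀ (f : Lp ℂ 2 μ), ‖(Lp.memLp f).norm.toLp _‖ = ‖f‖ := fun f => by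
    rw [Lp.norm_toLp, eLpNorm_norm, Lp.norm_def]
  rw [e, e, L2.inner_def] at h
  refine (integral_congr_ae ?_).trans_le h
  filter_upwards [hf.coeFn_toLp, hg.coeFn_toLp] with l h1 h2
  simp [h1, h2, mul_comm]

/-- For an even function, vanishing of the moments with respect to `λ² + δ²` implies vanishing of all
the moments with respect to `λ`. The moments exist because of `2 δ |λ| ≤ λ² + δ²`. -/
theorem integral_pow_eq_zero_of_even {F : ℝ → ℂ} {δ : ℝ} (hδ : 0 < δ)
    (hF_even : ∀ᵐ l, F (-l) = F l)
    (hint : ∀ m : ℕ, Integrable fun l : ℝ => (l ^ 2 + δ ^ 2) ^ m * ‖F l‖)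
    (hF : AEStronglyMeasurable F)
    (hzero : ∀ m : ℕ, ∫ l : ℝ, ((l ^ 2 + δ ^ 2 : ℝ) : ℂ) ^ m * F l = 0) (n : ℕ) :
    Integrable (fun l : ℝ => |l| ^ n * ‖F l‖) ∧ ∫ l : ℝ, (l : ℂ) ^ n * F l = 0 := by
  have hle : ∀ l : ℝ, |l| ≤ (2 * δ)⁻¹ * (l ^ 2 + δ ^ 2) := fun l => by
    rw [inv_mul_eq_div, le_div_iff₀ (by positivity), ← sq_abs l]
    nlinarith [sq_nonneg (|l| - δ)]
  have hI : ∀ k j : ℕ, Integrable fun l : ℝ =>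
      (l : ℂ) ^ k * ((l ^ 2 + δ ^ 2 : ℝ) : ℂ) ^ j * F l := fun k j => by
    refine ((hint (k + j)).const_mul ((2 * δ)⁻¹ ^ k)).mono'
      ((Continuous.aestronglyMeasurable (by fun_prop)).mul hF) (.of_forall fun l => ?_)
    rw [norm_mul, norm_mul, norm_pow, norm_pow, Complex.norm_real, Complex.norm_real,
      Real.norm_eq_abs, Real.norm_of_nonneg (by positivity), pow_add, ← mul_assoc, ← mul_assoc,
      ← mul_pow]
    gcongr
    exact hle l
  have heven : ∀ k j : ℕ, ∫ l : ℝ, (l : ℂ) ^ (2 * k) * ((l ^ 2 + δ ^ 2 : ℝ) : ℂ) ^ j * F l = 0 := by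
    intro k
    induction k with
    | zero => intro j; simpa using hzero j
    | succ k ih =>
      intro j
      have h : (fun l : ℝ => (l : ℂ) ^ (2 * (k + 1)) * ((l ^ 2 + δ ^ 2 : ℝ) : ℂ) ^ j * F l) =
          fun l : ℝ => (l : ℂ) ^ (2 * k) * ((l ^ 2 + δ ^ 2 : ℝ) : ℂ) ^ (j + 1) * F l -
            (δ : ℂ) ^ 2 * ((l : ℂ) ^ (2 * k) * ((l ^ 2 + δ ^ 2 : ℝ) : ℂ) ^ j * F l) := by
        ext l
        push_cast
        ring
      rw [h, integral_sub (hI _ _) ((hI _ _).const_mul _), integral_const_mul, ih, ih, mul_zero,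
        sub_zero]
  refine ⟨?_, ?_⟩
  · have := (hI n 0).norm
    simpa using this
  · rcases Nat.even_or_odd' n with ⟨k, rfl | rfl⟩
    · simpa using heven k 0
    · have h1 : ∫ l : ℝ, (l : ℂ) ^ (2 * k + 1) * F l =
          ∫ l : ℝ, -((l : ℂ) ^ (2 * k + 1) * F l) := by
        rw [← integral_neg_eq_self]
        refine integral_congr_ae ?_
        filter_upwards [hF_even] with l hl
        rw [hl, Complex.ofReal_neg, Odd.neg_pow ⟨k, rfl⟩]
        ring
      rw [integral_neg] at h1
      exact self_eq_neg.1 h1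

/-- If `k` is orthogonal to `x^m h` for all `m`, where `x = λ² + δ²`, and the norms of the functions
`x^m h` satisfy Carleman's condition, then `h · conj k` vanishes: it is even, so that all its moments
with respect to `λ` vanish, and those of order `2m` are at most `‖k‖ ‖x^m h‖`. -/
theorem ae_mul_conj_eq_zero {wt : ℝ → ℝ} (hwt_meas : Measurable wt)
    (hwt_pos : ∀ l, l ≠ 0 → 0 < wt l) (hwt_even : ∀ l, wt (-l) = wt l) {δ : ℝ} (hδ : 0 < δ)
    (h : ℕ → LineL2 wt) (k : LineL2 wt)
    (hh : ∀ m, ∀ᵐ l ∂lineMeasure wt, h m l = ((l ^ 2 + δ ^ 2 : ℝ) : ℂ) ^ m * h 0 l)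
    (hh_even : ∀ᵐ l, h 0 (-l) = h 0 l) (hk_even : ∀ᵐ l, k (-l) = k l)
    (horth : ∀ m, inner ℂ k (h m) = 0) {b : ℕ → ℝ} {B : ℝ} (hB : 0 ≤ B) (hb0 : ∀ m, 0 ≤ b m)
    (hb : ∀ m, ‖h m‖ ≤ B * b m)
    (hcarleman : ∑' m : ℕ, ENNReal.ofReal (b (m + 1)) ^ (-(1 / (2 * ((m : ℝ) + 1)))) = ⊤) :
    ∀ᵐ l, h 0 l * conj (k l) = 0 := by
  set F : ℝ → ℂ := fun l => (wt l : ℂ) * (h 0 l * conj (k l)) with hF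
  have hF_even : ∀ᵐ l, F (-l) = F l := by
    filter_upwards [hh_even, hk_even] with l h1 h2
    simp only [hF, h1, h2, hwt_even]
  have hin : ∀ m, (fun l => inner ℂ (k l) (h m l)) =ᵐ[lineMeasure wt]
      fun l => ((l ^ 2 + δ ^ 2 : ℝ) : ℂ) ^ m * (h 0 l * conj (k l)) := fun m => by
    filter_upwards [hh m] with l hl
    rw [RCLike.inner_apply, hl, mul_assoc]
  have hFeq : ∀ m : ℕ, (fun l => (wt l : ℂ) * (((l ^ 2 + δ ^ 2 : ℝ) : ℂ) ^ m *
      (h 0 l * conj (k l)))) = fun l : ℝ => ((l ^ 2 + δ ^ 2 : ℝ) : ℂ) ^ m * F l := fun m => by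
    ext l
    simp only [hF]
    ring
  have hintL : ∀ m : ℕ, Integrable (fun l => ((l ^ 2 + δ ^ 2 : ℝ) : ℂ) ^ m *
      (h 0 l * conj (k l))) (lineMeasure wt) := fun m =>
    (L2.integrable_inner k (h m)).congr (hin m)
  have hint' : ∀ m : ℕ, Integrable fun l : ℝ => ((l ^ 2 + δ ^ 2 : ℝ) : ℂ) ^ m * F l := fun m => by
    rw [← hFeq]
    exact (integrable_lineMeasure_iff hwt_meas hwt_pos).1 (hintL m)
  have hFm : AEStronglyMeasurable F := by simpa using (hint' 0).aestronglyMeasurable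
  have hnorm : ∀ (m : ℕ) (l : ℝ), ‖((l ^ 2 + δ ^ 2 : ℝ) : ℂ) ^ m * F l‖ =
      (l ^ 2 + δ ^ 2) ^ m * ‖F l‖ := fun m l => by
    rw [norm_mul, norm_pow, Complex.norm_real, Real.norm_of_nonneg (by positivity)]
  have hint : ∀ m : ℕ, Integrable fun l : ℝ => (l ^ 2 + δ ^ 2) ^ m * ‖F l‖ := fun m => by
    simpa only [hnorm] using (hint' m).norm
  have hzero : ∀ m : ℕ, ∫ l : ℝ, ((l ^ 2 + δ ^ 2 : ℝ) : ℂ) ^ m * F l = 0 := fun m => by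
    rw [← hFeq, ← integral_lineMeasure hwt_meas hwt_pos, ← integral_congr_ae (hin m),
      ← L2.inner_def, horth]
  have hmom := integral_pow_eq_zero_of_even hδ hF_even hint hFm hzero
  have hbound : ∀ m : ℕ, ∫ l : ℝ, |l| ^ (2 * m) * ‖F l‖ ≤ (‖k‖ * B + 1) * b m := fun m => by
    have h1 : ∫ l : ℝ, (l ^ 2 + δ ^ 2) ^ m * ‖F l‖ = ∫ l, ‖k l‖ * ‖h m l‖ ∂lineMeasure wt := by
      have h2 := integral_lineMeasure hwt_meas hwt_pos fun l => ((‖k l‖ * ‖h m l‖ : ℝ) : ℂ)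
      rw [integral_complex_ofReal] at h2
      simp only [← Complex.ofReal_mul] at h2
      rw [integral_complex_ofReal, Complex.ofReal_inj] at h2
      rw [h2]
      refine integral_congr_ae ?_
      have h3 := hh m
      rw [ae_lineMeasure_iff hwt_meas hwt_pos] at h3
      filter_upwards [h3, Measure.ae_ne volume 0] with l hl hl0
      rw [← hnorm, hl, hF]
      simp only [norm_mul, Complex.norm_real, Real.norm_of_nonneg (hwt_pos l hl0).le,
        RCLike.norm_conj]
      ring
    calc ∫ l : ℝ, |l| ^ (2 * m) * ‖F l‖ ≤ ∫ l : ℝ, (l ^ 2 + δ ^ 2) ^ m * ‖F l‖ := by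
          refine integral_mono (hmom _).1 (hint m) fun l => ?_
          simp only
          rw [pow_mul, sq_abs]
          gcongr
          nlinarith [sq_nonneg δ]
      _ ≤ ‖k‖ * ‖h m‖ := h1.trans_le (integral_norm_mul_norm_le k (h m))
      _ ≤ ‖k‖ * (B * b m) := by gcongr; exact hb m
      _ ≤ _ := by linarith [hb0 m]
  have hF0 : F =ᵐ[volume] 0 := by
    refine ae_eq_zero_of_moments_eq_zero F hFm (fun n => (hmom n).1) (fun n => (hmom n).2)
      fun hpos hsum => ?_
    set M : ℕ → ℝ := fun n => ∫ l : ℝ, |l| ^ n * ‖F l‖ with hM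
    set C := ‖k‖ * B + 1 with hC
    have hC1 : 1 ≤ C := by
      have : 0 ≤ ‖k‖ * B := by positivity
      linarith
    have hbpos : ∀ m, 0 < b m := fun m =>
      pos_of_mul_pos_right ((hpos (2 * m)).trans_le (hbound m)) (by linarith)
    have hsum2 : Summable fun m : ℕ => b (m + 1) ^ (-(1 / (2 * ((m : ℝ) + 1)))) := by
      refine Summable.of_nonneg_of_le (fun m => Real.rpow_nonneg (hb0 _) _) (fun m => ?_)
        ((hsum.comp_injective (i := fun m => 2 * m + 1) fun i j hij => by
          simp only at hij; omega).mul_left C)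
      simp only [Function.comp_apply]
      have e : ((2 * m + 1 : ℕ) : ℝ) + 1 = 2 * ((m : ℝ) + 1) := by push_cast; ring
      rw [e, show 2 * m + 1 + 1 = 2 * (m + 1) by ring]
      set s := 1 / (2 * ((m : ℝ) + 1)) with hs
      have hs0 : 0 ≤ s := by positivity
      have hs1 : s ≤ 1 := by
        rw [hs, div_le_one (by positivity)]
        linarith [Nat.cast_nonneg (α := ℝ) m]
      have hMp := hpos (2 * (m + 1))
      calc b (m + 1) ^ (-s) = C ^ s * (C * b (m + 1)) ^ (-s) := by
            rw [Real.mul_rpow (by linarith) (hb0 _), ← mul_assoc, ← Real.rpow_add (by linarith)]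
            simp
        _ ≤ C * M (2 * (m + 1)) ^ (-s) := by
            refine mul_le_mul ?_ (Real.rpow_le_rpow_of_nonpos hMp (hbound _) (by linarith))
              (Real.rpow_nonneg (mul_nonneg (by linarith) (hb0 _)) _) (by linarith)
            simpa using Real.rpow_le_rpow_of_exponent_le hC1 hs1
    refine hsum2.tsum_ofReal_ne_top ?_
    rw [← hcarleman]
    exact tsum_congr fun m => (ENNReal.ofReal_rpow_of_pos (hbpos _)).symm
  filter_upwards [hF0, Measure.ae_ne volume 0] with l hl hl0
  exact (mul_eq_zero.1 hl).resolve_left (by exact_mod_cast (hwt_pos l hl0).ne')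

/-! ### The abstract Chernoff theorem -/

theorem exists_setIntegral_ne_zero {w : ℝ → ℝ} (hw_meas : Measurable w)
    (hw_pos : ∀ r, 0 < r → 0 < w r) (hfin : ∀ R, halfLineMeasure w (Ioo 0 R) < ⊤) {v : ℝ → ℂ}
    (hvc : ContinuousOn v (Ici 0)) (hv0 : v 0 = 1) {η : ℝ} (hη : 0 < η) :
    ∃ j : ℕ, ∫ r in Ioo 0 (η / (j + 1)), conj (v r) ∂halfLineMeasure w ≠ 0 := by
  have h1 : ∀ᶠ r in 𝓝[Ici 0] (0 : ℝ), ‖v r - 1‖ < 1 / 2 := by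
    have := ((hvc 0 self_mem_Ici).sub (continuousWithinAt_const (b := (1 : ℂ)))).norm
    exact this.eventually (gt_mem_nhds (by simp [hv0]))
  obtain ⟨ε, hε, h2⟩ := Metric.mem_nhdsWithin_iff.1 h1
  obtain ⟨j, hj⟩ := exists_nat_gt (η / ε)
  have hj1 : (0 : ℝ) < (j : ℝ) + 1 := by positivity
  have hjε : η / ((j : ℝ) + 1) < ε := by
    rw [div_lt_iff₀ hε] at hj
    rw [div_lt_iff₀ hj1]
    nlinarith
  refine ⟨j, fun h0 => ?_⟩
  set s := Ioo (0 : ℝ) (η / ((j : ℝ) + 1)) with hs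
  have hsfin := hfin (η / ((j : ℝ) + 1))
  have hclose : ∀ r ∈ s, ‖conj (v r) - 1‖ ≤ 1 / 2 := fun r hr => by
    have : r ∈ Metric.ball 0 ε ∩ Ici 0 := by
      simp [abs_of_pos hr.1, hr.2.trans hjε, hr.1.le]
    have h3 : ‖v r - 1‖ < 1 / 2 := h2 this
    rw [← map_one conj, ← map_sub, RCLike.norm_conj]
    exact h3.le
  have : IsFiniteMeasure ((halfLineMeasure w).restrict s) := ⟨by simpa using hsfin⟩
  have hsub : IntegrableOn (fun r => conj (v r) - 1) s (halfLineMeasure w) := by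
    refine Integrable.of_bound ?_ (1 / 2) (ae_restrict_of_forall_mem measurableSet_Ioo hclose)
    have : ContinuousOn (fun r => conj (v r) - 1) s :=
      ((Complex.continuous_conj.comp_continuousOn (hvc.mono fun r hr => hr.1.le)).sub
        continuousOn_const)
    exact this.aestronglyMeasurable measurableSet_Ioo
  have hsplit : ∫ r in s, conj (v r) ∂halfLineMeasure w =
      ∫ r in s, (conj (v r) - 1) ∂halfLineMeasure w + ((halfLineMeasure w).real s : ℂ) := by
    have := integral_add hsub (integrable_const (1 : ℂ))
    simpa using this
  have hb := norm_setIntegral_le_of_norm_le_const hsfin hclose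
  have hpos : 0 < (halfLineMeasure w).real s :=
    ENNReal.toReal_pos (halfLineMeasure_Ioo_pos hw_meas hw_pos (by positivity)).ne' hsfin.ne
  rw [h0] at hsplit
  have h5 := eq_neg_of_add_eq_zero_left hsplit.symm
  rw [h5, norm_neg, Complex.norm_real, Real.norm_of_nonneg hpos.le] at hb
  linarith

end Chernoff

open Chernoff in
theorem mainTheorem5
    (w wt : ℝ → ℝ) (hw_meas : Measurable w) (hw_pos : ∀ r, 0 < r → 0 < w r)
    (hwt_meas : Measurable wt) (hwt_pos : ∀ lam, lam ≠ 0 → 0 < wt lam)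
    (hwt_even : ∀ lam, wt (-lam) = wt lam)
    (hwt_growth : ∃ (C : ℝ) (N : ℕ), ∀ lam, wt lam ≤ C * (1 + |lam|) ^ N)
    (n : ℕ) (a : ℕ → ℝ → ℂ) (ha : ∀ k, ContDiffOn ℝ ∞ (a k) (Ioi 0))
    (D : Submodule ℂ (ℝ → ℂ)) (hD : Chernoff.IsInitialDomain w n a D)
    (hL : Chernoff.IsEssentiallySelfAdjoint w n a D)
    (δ : ℝ) (hδ : 0 < δ) (ψ : ℝ → ℝ → ℂ)
    (hψ_local : ∀ lam, Chernoff.IsLocallyIn D (ψ lam))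
    (hψ_eigen : ∀ lam, ∀ r, 0 < r →
      Chernoff.diffOp n a (ψ lam) r = ((lam ^ 2 + δ ^ 2 : ℝ) : ℂ) * ψ lam r)
    (hψ_bdd : ∀ lam, ∃ B : ℝ, ∀ r, 0 < r → ‖ψ lam r‖ ≤ B)
    (hψ_cont : ∀ lam, ContinuousOn (ψ lam) (Ici 0))
    (hψ_zero : ∀ lam, ψ lam 0 = 1)
    (hψ_even : ∀ lam r, ψ (-lam) r = ψ lam r)
    (T : Chernoff.HalfLineL2 w →ₗ[ℂ] Chernoff.LineL2 wt)
    (hT : Chernoff.IsEigenfunctionTransform w wt ψ T)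
    (c : ℝ) (hc : 0 < c)
    (hinv : Chernoff.InversionFormula w wt ψ c T)
    (hplanch : Chernoff.PlancherelFormula w wt c T)
    (f : Chernoff.HalfLineL2 w) (g : ℕ → Chernoff.HalfLineL2 w)
    (hg : ∀ m, Chernoff.IsPower w n a m f (g m))
    (hcarleman : ∑' m : ℕ, ‖g (m + 1)‖ₑ ^ (-(1 / (2 * ((m : ℝ) + 1)))) = ⊤)
    (hvanish : ∃ η : ℝ, 0 < η ∧ ∀ᵐ r ∂volume.restrict (Ioo 0 η), f r = 0) :
    f = 0 := by
  obtain ⟨η, hη, hf⟩ := hvanish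
  obtain ⟨A, hA, hgraph⟩ := hL
  have hfin : ∀ R, halfLineMeasure w (Ioo 0 R) < ⊤ :=
    halfLineMeasure_Ioo_lt_top hD (hψ_local 0) (hψ_cont 0) (hψ_zero 0)
  have hf' : ∀ᵐ r ∂halfLineMeasure w, r < η → f r = 0 := by
    refine (halfLineMeasure_absolutelyContinuous w).ae_le ((ae_restrict_iff' measurableSet_Ioi).2 ?_)
    rw [ae_restrict_iff' measurableSet_Ioo] at hf
    filter_upwards [hf] with r hr h0 h1 using hr ⟨h0, h1⟩
  -- `g 0` is replaced by `f` itself, with which it agrees almost everywhere.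
  let G : ℕ → HalfLineL2 w := fun m => Nat.casesOn m f fun m => g (m + 1)
  have hG : ∀ m, IsPower w n a m f (G m) := fun m => by
    cases m with
    | zero => intro φ _; rfl
    | succ m => exact hg (m + 1)
  have hG0 : ∀ m, ∀ᵐ r ∂halfLineMeasure w, r < η → G m r = 0 := fun m =>
    (hG m).ae_eq_zero ha hfin hf'
  have hmem : ∀ m, (G m, G (m + 1)) ∈ A.graph := fun m =>
    mem_graph_of_ae_eq_zero hD hA hgraph (fun φ hφ => by
      rw [← hG m _ (hφ.diffOp ha), ← hG (m + 1) φ hφ, Function.iterate_succ_apply]) hη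
      (hG0 m) (hG0 (m + 1))
  have hpow : ∀ m, ∀ᵐ l ∂lineMeasure wt, conjTransform T (G m) l =
      ((l ^ 2 + δ ^ 2 : ℝ) : ℂ) ^ m * conjTransform T f l := fun m => by
    induction m with
    | zero => exact .of_forall fun l => by rw [pow_zero, one_mul]; rfl
    | succ m ih =>
      have hcl : (G m, G (m + 1)) ∈ closure _ := hgraph ▸ (SetLike.mem_coe.2 (hmem m))
      filter_upwards [ih, conjTransform_intertwines hD ⟨A, hA, hgraph⟩ hψ_local hψ_eigen hfin hc hT
        hplanch hcl] with l h1 h2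
      rw [h2, h1, ← mul_assoc, ← pow_succ']
  have heven := conjTransform_even hwt_meas hwt_pos hc hψ_even hT hplanch
  have hprod : ∀ j : ℕ, ∀ᵐ l, conjTransform T f l *
      conj (∫ r in Ioo 0 (η / (j + 1)), conj (ψ l r) ∂halfLineMeasure w) = 0 := fun j => by
    set s := Ioo (0 : ℝ) (η / ((j : ℝ) + 1)) with hs
    have hsη : ∀ r ∈ s, r < η := fun r hr => hr.2.trans_le
      (div_le_self hη.le (by linarith [Nat.cast_nonneg (α := ℝ) j]))
    have hsfin := hfin (η / ((j : ℝ) + 1))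
    let k : HalfLineL2 w := indicatorConstLp 2 (measurableSet_Ioo : MeasurableSet s) hsfin.ne 1
    have hkint : Integrable k (halfLineMeasure w) :=
      Integrable.congr ((integrable_indicator_iff measurableSet_Ioo).2
        (integrableOn_const hsfin.ne)) indicatorConstLp_coeFn.symm
    have horth : ∀ m, inner ℂ (conjTransform T k) (conjTransform T (G m)) = 0 := fun m => by
      have h1 := inner_conjTransform hc hplanch k (G m)
      have h2 : inner ℂ k (G m) = 0 := by
        rw [L2.inner_indicatorConstLp_one]
        refine integral_eq_zero_of_ae ?_
        rw [Filter.EventuallyEq, ae_restrict_iff' measurableSet_Ioo]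
        filter_upwards [hG0 m] with r hr hrs using hr (hsη r hrs)
      rw [h2] at h1
      exact (mul_eq_zero.1 h1.symm).resolve_left (by exact_mod_cast hc.ne')
    have hz := ae_mul_conj_eq_zero hwt_meas hwt_pos hwt_even hδ (fun m => conjTransform T (G m))
      (conjTransform T k) hpow (heven f) (heven k) horth (b := fun m => ‖G m‖) (B := (√c)⁻¹)
      (by positivity) (fun m => norm_nonneg _) (fun m => norm_conjTransform_le hc hplanch _)
      (by rw [← hcarleman]; exact tsum_congr fun m => by rw [ofReal_norm])
    have hk := conjTransform_ae_eq hT hkint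
    rw [Filter.EventuallyEq, ae_lineMeasure_iff hwt_meas hwt_pos] at hk
    filter_upwards [hz, hk] with l h1 h2
    rw [h2] at h1
    have h3 : ∫ r, k r * conj (ψ l r) ∂halfLineMeasure w =
        ∫ r in s, conj (ψ l r) ∂halfLineMeasure w := by
      rw [← integral_indicator measurableSet_Ioo]
      refine integral_congr_ae ?_
      filter_upwards [indicatorConstLp_coeFn (hs := (measurableSet_Ioo : MeasurableSet s))
        (hμs := hsfin.ne) (c := (1 : ℂ)) (p := 2)] with r hr
      rw [hr]
      by_cases hrs : r ∈ s
      · rw [indicator_of_mem hrs, indicator_of_mem hrs, one_mul]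
      · rw [indicator_of_notMem hrs, indicator_of_notMem hrs, zero_mul]
    rwa [h3] at h1
  have hTf : conjTransform T f = 0 := by
    rw [Lp.eq_zero_iff_ae_eq_zero, Filter.EventuallyEq, ae_lineMeasure_iff hwt_meas hwt_pos]
    filter_upwards [ae_all_iff.2 hprod] with l hl
    obtain ⟨j, hj⟩ := exists_setIntegral_ne_zero hw_meas hw_pos hfin (hψ_cont l) (hψ_zero l) hη
    exact (mul_eq_zero.1 (hl j)).resolve_right
      ((map_ne_zero_iff _ (starRingEnd ℂ).injective).2 hj)
  have := norm_sq_conjTransform hplanch f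
  rw [hTf] at this
  simpa using this
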